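/- Let $p$ be a prime. A partial group is a set $\mathcal L$ with a product $\Pi:\mathbf D\to\mathcal L$ defined on a set $\mathbf D$ of words in $\mathcal L$ and an involutory inversion on $\mathcal L$, subject to Chermak's axioms: all words of length one lie in $\mathbf D$ and $\Pi$ is the identity on them; subwords (initial and final segments) of words in $\mathbf D$ are in $\mathbf D$; if $u\circ v\circ w\in\mathbf D$ then $u\circ(\Pi(v))\circ w\in\mathbf D$ and both have the same product; if $w=(f_1,\dots,f_n)\in\mathbf D$ and $w^{-1}=(f_n^{-1},\dots,f_1^{-1})$, then $w^{-1}\circ w\in\mathbf D$ and $\Pi(w^{-1}\circ w)=\mathbf 1:=\Pi(\emptyset)$. For $x,g\in\mathcal L$ the conjugate $x^g:=\Pi(g^{-1},x,g)$ is defined if $(g^{-1},x,g)\in\mathbf D$. For $X\subseteq\mathcal L$, $N_{\mathcal L}(X)$ is the set of $g\in\mathcal L$ such that $x^g$ is defined for all $x\in X$ and $\{x^g: x\in X\}=X$, and $C_{\mathcal L}(X)$ is the set of $g\in\mathcal L$ such that, for all $x\in X$, $x^g$ is defined and equals $x$. A subgroup of $\mathcal L$ is a subset $H$, closed under inversion and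 products, such that all words in $H$ lie in $\mathbf D$; it is a $p$-subgroup if it is a finite $p$-group. A locality is a triple $(\mathcal L,\Delta,S)$ where $\mathcal L$ is a finite partial group, $S$ is a maximal $p$-subgroup of $\mathcal L$, and $\Delta$ is a non-empty set of subgroups of $S$ such that: $\mathbf D$ is the set of words $(f_1,\dots,f_n)$ for which there are $P_0,\dots,P_n\in\Delta$ with $P_{i-1}^{f_i}$ defined and equal to $P_i$ for all $i$; if $P\in\Delta$, $g\in\mathcal L$ and $P^g$ is defined and contained in $S$, then $P^g\in\Delta$; and every subgroup of $S$ containing an element of $\Delta$ is in $\Delta$. It is of objective characteristic $p$ if, for every $P\in\Delta$, the finite group $G=N_{\mathcal L}(P)$ satisfies $C_G(O_p(G))\le O_p(G)$. It is a locality over $\mathcal F$ if $\mathcal F=\mathcal F_S(\mathcal L)$, the fusion system over $S$ generated by the conjugation maps $x\mapsto x^g$ ($g\in\mathcal L$) between subgroups of $S$. A subgroup $Q\le S$ is normal in $\mathcal F$ if $Q\trianglelefteq S$ and, for all $P,R\le S$, every morphism $P\to R$ in $\mathcal F$ extends to a morphism $PQ\to RQ$ in $\mathcal F$ mapping $Q$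 onto $Q$. It is central in $\mathcal F$ if $Q\le Z(S)$ and every such morphism extends to a morphism $PQ\to RQ$ in $\mathcal F$ that is the identity on $Q$; $Z(\mathcal F)$ is the largest central subgroup. Let $(\mathcal L,\Delta,S)$ be a locality over $\mathcal F$ of objective characteristic $p$, and let $Q\le S$ be a subgroup. Then $Q$ is normal in $\mathcal F$ if and only if $\mathcal L=N_{\mathcal L}(Q)$. Similarly, $Q\le Z(\mathcal F)$ if and only if $\mathcal L=C_{\mathcal L}(Q)$. -/

import Mathlib

/-- A partial group: a set `L` with a product defined on a set `dom` of words in `L`, and an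
involutory inversion. The function `prod` is total, but only its values on words in `dom` carry
information, and only those occur below. The identity element is `prod []`. -/
class PartialGroup (L : Type*) where
  /-- the set of words whose product is defined -/
  dom : Set (List L)
  /-- the product; only its values on `dom` matter -/
  prod : List L → L
  /-- the inversion -/
  inv : L → L
  inv_inv : ∀ x, inv (inv x) = x
  single_mem : ∀ x, [x] ∈ dom
  left_mem : ∀ u v, u ++ v ∈ dom → u ∈ dom
  right_mem : ∀ u v, u ++ v ∈ dom → v ∈ dom
  prod_single : ∀ x, prod [x] = x
  contract_mem : ∀ u v w, u ++ v ++ w ∈ dom → u ++ [prod v] ++ w ∈ dom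
  prod_contract : ∀ u v w, u ++ v ++ w ∈ dom → prod (u ++ v ++ w) = prod (u ++ [prod v] ++ w)
  inv_append_mem : ∀ w, w ∈ dom → (w.map inv).reverse ++ w ∈ dom
  prod_inv_append : ∀ w, w ∈ dom → prod ((w.map inv).reverse ++ w) = prod []

namespace PartialGroup

section Basic

variable {L : Type*} [PartialGroup L]

/-- The set of elements `x` for which the conjugate `x ^ g` is defined. -/
def conjDom (g : L) : Set L := {x | [inv g, x, g] ∈ dom}

/-- The conjugate `x ^ g = g⁻¹ x g` (meaningful if `x ∈ conjDom g`). -/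
def conj (x g : L) : L := prod [inv g, x, g]

/-- `X ^ g` is defined and equals `Y`. -/
def ConjTo (X : Set L) (g : L) (Y : Set L) : Prop :=
  X ⊆ conjDom g ∧ (fun x => conj x g) '' X = Y

/-- The normalizer of the subset `X`: all `g` such that `X ^ g` is defined and equals `X`. -/
def normalizer (X : Set L) : Set L := {g | ConjTo X g X}

/-- The centralizer of the subset `X`: all `g` such that `x ^ g` is defined and equals `x`
for all `x ∈ X`. -/
def centralizer (X : Set L) : Set L := {g | ∀ x ∈ X, x ∈ conjDom g ∧ conj x g = x}

theorem prod_append (u v : List L) (h : u ++ v ∈ dom) : prod (u ++ v) = prod [prod u, prod v] := by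
  have h1 := prod_contract [] u v (by simpa using h)
  have h2 := contract_mem [] u v (by simpa using h)
  have h3 := prod_contract [prod u] v [] (by simpa using h2)
  simp only [List.nil_append, List.append_nil, List.singleton_append] at h1 h3
  rw [h1, h3]

theorem prod_one_cons (w : List L) (h : w ∈ dom) :
    prod [] :: w ∈ dom ∧ prod (prod [] :: w) = prod w := by
  have h1 := prod_contract [] [] w (by simpa using h)
  have h2 := contract_mem [] [] w (by simpa using h)
  simp only [List.nil_append, List.singleton_append] at h1 h2
  exact ⟨h2, h1.symm⟩

theorem prod_cons (x : L) (w : List L) (h : x :: w ∈ dom) : prod (x :: w) = prod [x, prod w] := by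
  have h1 := prod_append [x] w (by simpa using h)
  rw [prod_single] at h1
  simpa using h1

theorem append_inv_mem (w : List L) (h : w ∈ dom) : w ++ (w.map inv).reverse ∈ dom := by
  have h0 : (w.map inv).reverse ∈ (dom : Set (List L)) := left_mem _ _ (inv_append_mem w h)
  have h1 := inv_append_mem _ h0
  simpa [List.map_reverse, Function.comp_def, inv_inv] using h1

theorem pair_inv (g : L) : [g, inv g] ∈ (dom : Set (List L)) ∧ prod [g, inv g] = prod [] := by
  have h1 := inv_append_mem _ (single_mem (inv g))
  have h2 := prod_inv_append _ (single_mem (inv g))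
  simp only [List.map_cons, List.map_nil, List.reverse_singleton, List.singleton_append,
    inv_inv] at h1 h2
  exact ⟨h1, h2⟩

theorem eq_inv_of_prod_eq_one (a b : L) (h : [a, b] ∈ (dom : Set (List L)))
    (h1 : prod [a, b] = prod []) : a = inv b := by
  have h2 : [a, b, inv b] ∈ (dom : Set (List L)) :=
    left_mem [a, b, inv b] [inv a] (by simpa using append_inv_mem _ h)
  have h3 := prod_append [a, b] [inv b] (by simpa using h2)
  have h4 := prod_append [a] [b, inv b] (by simpa using h2)
  have h5 : prod [prod [], inv b] = inv b := by
    rw [(prod_one_cons _ (single_mem (inv b))).2, prod_single]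
  have h6 := prod_contract [a] [] [] (by simpa using single_mem a)
  simp only [List.append_nil, prod_single, List.cons_append, List.nil_append] at h3 h4 h6
  rw [h1, h5] at h3
  rw [(pair_inv b).2, ← h6] at h4
  exact h4.symm.trans h3

theorem prod_inv_word (w : List L) (h : w ∈ dom) : prod (w.map inv).reverse = inv (prod w) := by
  have h1 := inv_append_mem w h
  have h2 := prod_inv_append w h
  rw [prod_append _ _ h1] at h2
  refine eq_inv_of_prod_eq_one _ _ ?_ h2
  have h3 := contract_mem [] _ w (by simpa using h1)
  have h4 := contract_mem [prod (w.map inv).reverse] w [] (by simpa using h3)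
  simpa using h4

theorem conj_conj_inv {x g : L} (h : x ∈ conjDom g) :
    conj x g ∈ conjDom (inv g) ∧ conj (conj x g) (inv g) = x := by
  have h1 := inv_append_mem _ (inv_append_mem _ h)
  simp only [List.map_cons, List.map_nil, List.reverse_cons, List.reverse_nil, List.nil_append,
    List.cons_append, inv_inv] at h1
  have h2 : [g, inv g, x, g, inv g] ∈ (dom : Set (List L)) :=
    left_mem _ _ (right_mem [inv g, inv x] ([g, inv g, x, g, inv g] ++ [inv x, g, inv g, x, g])
      (by simpa using h1))
  have h3 := contract_mem [g] [inv g, x, g] [inv g] (by simpa using h2)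
  have h4 := prod_contract [g] [inv g, x, g] [inv g] (by simpa using h2)
  have h5 := contract_mem [] [g, inv g] [x, g, inv g] (by simpa using h2)
  have h6 := prod_contract [] [g, inv g] [x, g, inv g] (by simpa using h2)
  have h7 := prod_contract [prod [], x] [g, inv g] [] (by simpa [(pair_inv g).2] using h5)
  have h8 := prod_contract [x] [] [] (by simpa using single_mem x)
  have h9 := contract_mem [x] [] [] (by simpa using single_mem x)
  simp only [List.append_nil, prod_single, List.cons_append, List.nil_append,
    (pair_inv g).2] at h3 h4 h6 h7 h8 h9
  refine ⟨by simpa [conjDom, conj, inv_inv] using h3, ?_⟩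
  simp only [conj, inv_inv]
  rw [← h4, h6, h7, (prod_one_cons _ h9).2, ← h8]

end Basic

end PartialGroup

open PartialGroup in
/-- A subgroup of the partial group `L`: a subset closed under inversion and products such that
the product of every word in it is defined. -/
@[ext]
structure SubgroupIn (L : Type*) [PartialGroup L] where
  carrier : Set L
  inv_mem : ∀ x ∈ carrier, inv x ∈ carrier
  word_mem : ∀ w : List L, (∀ x ∈ w, x ∈ carrier) → w ∈ dom
  prod_mem : ∀ w : List L, (∀ x ∈ w, x ∈ carrier) → prod w ∈ carrier

namespace SubgroupIn

open PartialGroup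

section Group

variable {L : Type*} [PartialGroup L]

instance : SetLike (SubgroupIn L) L where
  coe := carrier
  coe_injective _ _ h := SubgroupIn.ext h

/-- A subgroup of a partial group is a group under the restricted product. -/
instance (H : SubgroupIn L) : Group H :=
  letI : Mul H := ⟨fun x y => ⟨prod [x.1, y.1], H.prod_mem _ (by
    intro z hz
    simp only [List.mem_cons, List.not_mem_nil, or_false] at hz
    rcases hz with rfl | rfl
    · exact x.2
    · exact y.2)⟩⟩
  letI : One H := ⟨⟨prod [], H.prod_mem _ (by simp)⟩⟩
  letI : Inv H := ⟨fun x => ⟨inv x.1, H.inv_mem _ x.2⟩⟩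
  Group.ofLeftAxioms
    (by
      intro x y z
      have h : [x.1, y.1, z.1] ∈ (dom : Set (List L)) := H.word_mem _ (by
        intro t ht
        simp only [List.mem_cons, List.not_mem_nil, or_false] at ht
        rcases ht with rfl | rfl | rfl
        · exact x.2
        · exact y.2
        · exact z.2)
      have h1 := prod_append [x.1, y.1] [z.1] h
      have h2 := prod_append [x.1] [y.1, z.1] h
      rw [prod_single] at h1 h2
      exact Subtype.ext (h1.symm.trans h2))
    (fun x => Subtype.ext ((prod_one_cons _ (single_mem x.1)).2.trans (prod_single _)))
    (fun x => Subtype.ext (prod_inv_append _ (single_mem x.1)))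

theorem coe_mul (H : SubgroupIn L) (x y : H) : ((x * y : H) : L) = prod [x.1, y.1] := rfl

theorem coe_inv (H : SubgroupIn L) (x : H) : ((x⁻¹ : H) : L) = inv x.1 := rfl

theorem coe_one (H : SubgroupIn L) : ((1 : H) : L) = prod [] := rfl

/-- A subgroup of the group `S`, regarded as a subset of the partial group. -/
def toSet {S : SubgroupIn L} (P : Subgroup S) : Set L := Subtype.val '' (P : Set S)

theorem coe_conj (S : SubgroupIn L) (x s : S) :
    x.1 ∈ conjDom s.1 ∧ conj x.1 s.1 = ((s⁻¹ * x * s : S) : L) := by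
  have h : [inv s.1, x.1, s.1] ∈ (dom : Set (List L)) := S.word_mem _ (by
    intro t ht
    simp only [List.mem_cons, List.not_mem_nil, or_false] at ht
    rcases ht with rfl | rfl | rfl
    · exact S.inv_mem _ s.2
    · exact x.2
    · exact s.2)
  refine ⟨h, ?_⟩
  have h1 := prod_append [inv s.1, x.1] [s.1] h
  rw [prod_single] at h1
  exact h1

theorem toSet_subset_normalizer {S : SubgroupIn L} (P : Subgroup S) :
    toSet P ⊆ normalizer (toSet P) := by
  rintro _ ⟨s, hs, rfl⟩
  refine ⟨?_, ?_⟩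
  · rintro _ ⟨x, hx, rfl⟩
    exact (S.coe_conj x s).1
  · ext y
    constructor
    · rintro ⟨_, ⟨x, hx, rfl⟩, rfl⟩
      exact ⟨s⁻¹ * x * s, P.mul_mem (P.mul_mem (P.inv_mem hs) hx) hs, (S.coe_conj x s).2.symm⟩
    · rintro ⟨y, hy, rfl⟩
      refine ⟨_, ⟨s * y * s⁻¹, P.mul_mem (P.mul_mem hs hy) (P.inv_mem hs), rfl⟩, ?_⟩
      simp only [(S.coe_conj _ s).2]
      congr 1
      group

end Group

end SubgroupIn

section Locality

open PartialGroup SubgroupIn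

variable {L : Type*} [PartialGroup L] {S : SubgroupIn L}

/-- For `w = (f₁, …, fₙ)`: there are `P₁, …, Pₙ` such that `P = P₀, P₁, …, Pₙ` all lie in `Δ`
and, for each `i`, the conjugate of `Pᵢ₋₁` by `fᵢ` is defined and equals `Pᵢ`. -/
def Via (Δ : Set (Subgroup S)) : Subgroup S → List L → Prop
  | P, [] => P ∈ Δ
  | P, f :: w => P ∈ Δ ∧ ∃ Q : Subgroup S, ConjTo (toSet P) f (toSet Q) ∧ Via Δ Q w

/-- `(L, Δ, S)` is a locality (for the prime `p`). -/
structure IsLocality (p : ℕ) (Δ : Set (Subgroup S)) : Prop where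
  finite : Finite L
  isPGroup : IsPGroup p S
  nonempty : Δ.Nonempty
  /-- `S` is maximal among the `p`-subgroups of `L` -/
  maximal : ∀ T : SubgroupIn L, IsPGroup p T → (S : Set L) ⊆ T → T = S
  /-- the domain of the product consists of the words that act on chains of objects -/
  mem_dom_iff : ∀ w : List L, w ∈ dom ↔ ∃ P : Subgroup S, Via Δ P w
  /-- `Δ` is closed under taking `L`-conjugates -/
  conj_closed : ∀ P ∈ Δ, ∀ g : L, toSet P ⊆ conjDom g → (fun x => conj x g) '' toSet P ⊆ S →
    ∃ Q ∈ Δ, toSet Q = (fun x => conj x g) '' toSet P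
  /-- `Δ` is closed under taking overgroups in `S` -/
  overgroup_closed : ∀ P ∈ Δ, ∀ Q : Subgroup S, P ≤ Q → Q ∈ Δ

namespace IsLocality

variable {p : ℕ} {Δ : Set (Subgroup S)}

theorem word_mem (h : IsLocality p Δ) {P : Subgroup S} (hP : P ∈ Δ) (w : List L)
    (hw : ∀ x ∈ w, x ∈ PartialGroup.normalizer (toSet P)) : w ∈ dom := by
  refine (h.mem_dom_iff w).2 ⟨P, ?_⟩
  induction w with
  | nil => exact hP
  | cons f w ih =>
    exact ⟨hP, P, hw f (by simp), ih fun x hx => hw x (by simp [hx])⟩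

theorem inv_mem_normalizer {X : Set L} {g : L} (hg : g ∈ PartialGroup.normalizer X) :
    inv g ∈ PartialGroup.normalizer X := by
  obtain ⟨h1, h2⟩ := hg
  refine ⟨?_, ?_⟩
  · intro x hx
    rw [← h2] at hx
    obtain ⟨y, hy, rfl⟩ := hx
    exact (conj_conj_inv (h1 hy)).1
  · ext x
    constructor
    · rintro ⟨z, hz, rfl⟩
      rw [← h2] at hz
      obtain ⟨y, hy, rfl⟩ := hz
      simpa only [(conj_conj_inv (h1 hy)).2] using hy
    · intro hx
      refine ⟨conj x g, ?_, (conj_conj_inv (h1 hx)).2⟩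
      rw [← h2]
      exact ⟨x, hx, rfl⟩

theorem mul_mem_normalizer (h : IsLocality p Δ) {P : Subgroup S} (hP : P ∈ Δ) {f g : L}
    (hf : f ∈ PartialGroup.normalizer (toSet P)) (hg : g ∈ PartialGroup.normalizer (toSet P)) :
    prod [f, g] ∈ PartialGroup.normalizer (toSet P) := by
  have key : ∀ x ∈ toSet P, x ∈ conjDom (prod [f, g]) ∧
      conj x (prod [f, g]) = conj (conj x f) g := by
    intro x hx
    have hd : [inv g, inv f, x, f, g] ∈ (dom : Set (List L)) := h.word_mem hP _ (by
      intro t ht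
      simp only [List.mem_cons, List.not_mem_nil, or_false] at ht
      rcases ht with rfl | rfl | rfl | rfl | rfl
      · exact inv_mem_normalizer hg
      · exact inv_mem_normalizer hf
      · exact toSet_subset_normalizer P hx
      · exact hf
      · exact hg)
    have hfg : [f, g] ∈ (dom : Set (List L)) := right_mem [inv g, inv f, x] [f, g] hd
    have h1 := prod_inv_word _ hfg
    have h2 := contract_mem [] [inv g, inv f] [x, f, g] hd
    have h3 := contract_mem [prod [inv g, inv f], x] [f, g] [] (by simpa using h2)
    have h4 := prod_contract [] [inv g, inv f] [x, f, g] hd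
    have h5 := prod_contract [prod [inv g, inv f], x] [f, g] [] (by simpa using h2)
    have h6 := prod_contract [inv g] [inv f, x, f] [g] hd
    simp only [List.map_cons, List.map_nil, List.reverse_cons, List.reverse_nil, List.nil_append,
      List.cons_append, List.append_nil] at h1 h3 h4 h5 h6
    rw [h1] at h3 h4 h5
    exact ⟨h3, (h5.symm.trans h4.symm).trans h6⟩
  refine ⟨fun x hx => (key x hx).1, ?_⟩
  have : (fun x => conj x (prod [f, g])) '' toSet P =
      (fun x => conj x g) '' ((fun x => conj x f) '' toSet P) := by
    rw [Set.image_image]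
    exact Set.image_congr fun x hx => (key x hx).2
  rw [this, hf.2, hg.2]

/-- For an object `P` of a locality, the normalizer of `P` is a subgroup of `L`. -/
def normalizerSubgroup (h : IsLocality p Δ) {P : Subgroup S} (hP : P ∈ Δ) : SubgroupIn L where
  carrier := PartialGroup.normalizer (toSet P)
  inv_mem _ hx := inv_mem_normalizer hx
  word_mem w hw := h.word_mem hP w hw
  prod_mem w hw := by
    induction w with
    | nil => exact toSet_subset_normalizer P ⟨1, P.one_mem, rfl⟩
    | cons f w ih =>
      rw [prod_cons f w (h.word_mem hP _ hw)]
      exact h.mul_mem_normalizer hP (hw f (by simp)) (ih fun x hx => hw x (by simp [hx]))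

end IsLocality

/-- `O_p(G)`, the largest normal `p`-subgroup of the finite group `G`. -/
def pCore (p : ℕ) (G : Type*) [Group G] : Subgroup G :=
  sSup {N | N.Normal ∧ IsPGroup p N}

/-- The finite group `G` is of characteristic `p`, that is `C_G(O_p(G)) ≤ O_p(G)`. -/
def IsOfCharacteristic (p : ℕ) (G : Type*) [Group G] : Prop :=
  Subgroup.centralizer (pCore p G : Set G) ≤ pCore p G

/-- The locality is of objective characteristic `p`: the normalizer of each object is a group of
characteristic `p`. -/
def IsLocality.IsOfObjectiveCharacteristic {p : ℕ} {Δ : Set (Subgroup S)}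
    (h : IsLocality p Δ) : Prop :=
  ∀ (P : Subgroup S) (hP : P ∈ Δ), IsOfCharacteristic p (h.normalizerSubgroup hP)

end Locality

/-- A fusion system over the finite `p`-group `S`: the category whose objects are the subgroups of
`S`, with morphism sets `Hom P Q` of injective homomorphisms that include all maps induced by
conjugation in `S`, such that every morphism is an isomorphism of the category followed by an
inclusion. -/
@[ext]
structure FusionSystem (S : Type*) [Group S] where
  Hom : (P Q : Subgroup S) → Set (P →* Q)
  injective : ∀ {P Q : Subgroup S} (φ : P →* Q), φ ∈ Hom P Q → Function.Injective φ
  conj_mem : ∀ {P Q : Subgroup S} (φ : P →* Q) (s : S),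
    (∀ x : P, (φ x : S) = s⁻¹ * x * s) → φ ∈ Hom P Q
  comp_mem : ∀ {P Q R : Subgroup S} (φ : P →* Q) (ψ : Q →* R),
    φ ∈ Hom P Q → ψ ∈ Hom Q R → ψ.comp φ ∈ Hom P R
  /-- If a morphism is a group isomorphism `α` onto a subgroup `R` followed by the inclusion
  of `R` (by injectivity every morphism is, in a unique way), then `α` and its inverse are
  morphisms. -/
  factor_mem : ∀ {P Q R : Subgroup S} (hR : R ≤ Q) (α : P ≃* R),
    (Subgroup.inclusion hR).comp α.toMonoidHom ∈ Hom P Q →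
      α.toMonoidHom ∈ Hom P R ∧ α.symm.toMonoidHom ∈ Hom R P

namespace FusionSystem

section General

variable {S : Type*} [Group S]

/-- The smallest fusion system over `S` containing a given family `K` of injective homomorphisms
between subgroups of `S`: the intersection of all fusion systems containing `K`. -/
def generate (K : (P Q : Subgroup S) → Set (P →* Q)) : FusionSystem S where
  Hom P Q := {φ | Function.Injective φ ∧
    ∀ E : FusionSystem S, (∀ A B : Subgroup S, K A B ⊆ E.Hom A B) → φ ∈ E.Hom P Q}
  injective φ h := h.1
  conj_mem φ s h := by
    refine ⟨fun x y hxy => Subtype.ext ?_, fun E _ => E.conj_mem φ s h⟩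
    have h1 : (φ x : S) = φ y := by rw [hxy]
    rw [h, h] at h1
    simpa using h1
  comp_mem φ ψ hφ hψ := ⟨hψ.1.comp hφ.1, fun E hE => E.comp_mem φ ψ (hφ.2 E hE) (hψ.2 E hE)⟩
  factor_mem hR α h := ⟨⟨α.injective, fun E hE => (E.factor_mem hR α (h.2 E hE)).1⟩,
    ⟨α.symm.injective, fun E hE => (E.factor_mem hR α (h.2 E hE)).2⟩⟩

/-- `Q` is normal in the fusion system: it is normal in `S`, and every morphism from `P` to `R`
extends to a morphism from `PQ` to `RQ` that maps `Q` onto `Q`. -/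
def IsNormal (F : FusionSystem S) (Q : Subgroup S) : Prop :=
  Q.Normal ∧ ∀ (P R : Subgroup S), ∀ φ ∈ F.Hom P R, ∃ ψ ∈ F.Hom (P ⊔ Q) (R ⊔ Q),
    ψ.comp (Subgroup.inclusion le_sup_left) = (Subgroup.inclusion le_sup_left).comp φ ∧
    (Q.subgroupOf (P ⊔ Q)).map ψ = Q.subgroupOf (R ⊔ Q)

/-- `Q` is central in the fusion system: it is central in `S`, and every morphism from `P` to `R`
extends to a morphism from `PQ` to `RQ` that is the identity on `Q`. -/
def IsCentral (F : FusionSystem S) (Q : Subgroup S) : Prop :=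
  Q ≤ Subgroup.center S ∧ ∀ (P R : Subgroup S), ∀ φ ∈ F.Hom P R, ∃ ψ ∈ F.Hom (P ⊔ Q) (R ⊔ Q),
    ψ.comp (Subgroup.inclusion le_sup_left) = (Subgroup.inclusion le_sup_left).comp φ ∧
    ψ.comp (Subgroup.inclusion le_sup_right) = Subgroup.inclusion le_sup_right

/-- The center `Z(F)`, the largest central subgroup. -/
def center (F : FusionSystem S) : Subgroup S := sSup {Q | F.IsCentral Q}

theorem inclusion_mem (F : FusionSystem S) {P Q : Subgroup S} (h : P ≤ Q) :
    Subgroup.inclusion h ∈ F.Hom P Q :=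
  F.conj_mem _ 1 (by simp)

theorem IsCentral.sup {F : FusionSystem S} {Q T : Subgroup S} (hQ : F.IsCentral Q)
    (hT : F.IsCentral T) : F.IsCentral (Q ⊔ T) := by
  refine ⟨sup_le hQ.1 hT.1, fun P R φ hφ => ?_⟩
  obtain ⟨ψ, hψ, h1, h2⟩ := hQ.2 P R φ hφ
  obtain ⟨χ, hχ, h3, h4⟩ := hT.2 _ _ ψ hψ
  have e1 : P ⊔ (Q ⊔ T) ≤ P ⊔ Q ⊔ T := (sup_assoc P Q T).ge
  have e2 : R ⊔ Q ⊔ T ≤ R ⊔ (Q ⊔ T) := (sup_assoc R Q T).le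
  refine ⟨(Subgroup.inclusion e2).comp (χ.comp (Subgroup.inclusion e1)),
    F.comp_mem _ _ (F.comp_mem _ _ (F.inclusion_mem e1) hχ) (F.inclusion_mem e2), ?_, ?_⟩
  · ext x
    have h5 := DFunLike.congr_fun h1 x
    have h6 := DFunLike.congr_fun h3 (Subgroup.inclusion le_sup_left x)
    simp only [MonoidHom.comp_apply] at h5 h6
    rw [h5] at h6
    exact (congrArg Subtype.val h6 :)
  · have hle : Q ⊔ T ≤ P ⊔ (Q ⊔ T) := le_sup_right
    have key : Q ⊔ T ≤ ((((Subgroup.subtype _).comp (χ.comp (Subgroup.inclusion e1))).eqLocus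
        (Subgroup.subtype _)).map (Subgroup.subtype (P ⊔ (Q ⊔ T)))) := by
      refine sup_le ?_ ?_
      · intro q hq
        refine ⟨⟨q, hle (Subgroup.mem_sup_left hq)⟩, ?_, rfl⟩
        have h5 := DFunLike.congr_fun h2 ⟨q, hq⟩
        have h6 := DFunLike.congr_fun h3 (Subgroup.inclusion le_sup_right ⟨q, hq⟩)
        simp only [MonoidHom.comp_apply] at h5 h6
        rw [h5] at h6
        exact (congrArg Subtype.val h6 :)
      · intro q hq
        refine ⟨⟨q, hle (Subgroup.mem_sup_right hq)⟩, ?_, rfl⟩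
        exact congrArg Subtype.val (DFunLike.congr_fun h4 ⟨q, hq⟩)
    ext ⟨x, hx⟩
    obtain ⟨y, hy, hyx⟩ := key hx
    have : y = ⟨x, hle hx⟩ := Subtype.ext hyx
    subst this
    exact hy

theorem isCentral_bot (F : FusionSystem S) : F.IsCentral ⊥ := by
  refine ⟨bot_le, fun P R φ hφ => ?_⟩
  have e1 : P ⊔ ⊥ ≤ P := (sup_bot_eq P).le
  refine ⟨(Subgroup.inclusion le_sup_left).comp (φ.comp (Subgroup.inclusion e1)),
    F.comp_mem _ _ (F.comp_mem _ _ (F.inclusion_mem e1) hφ) (F.inclusion_mem _), rfl, ?_⟩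
  ext ⟨x, hx⟩
  obtain rfl := Subgroup.mem_bot.1 hx
  have : (⟨1, hx⟩ : (⊥ : Subgroup S)) = 1 := rfl
  rw [this, map_one, map_one]

/-- The center of a fusion system over a finite group is central, so that it is indeed the
largest central subgroup. -/
theorem isCentral_center [Finite S] (F : FusionSystem S) : F.IsCentral F.center := by
  classical
  have hfin : {Q | F.IsCentral Q}.Finite := Set.toFinite _
  have h : F.center = hfin.toFinset.sup id := by
    rw [Finset.sup_id_eq_sSup, Set.Finite.coe_toFinset]; rfl
  rw [h]
  exact Finset.sup_induction F.isCentral_bot (fun _ h1 _ h2 => h1.sup h2)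
    (fun Q hQ => by simpa using hQ)

end General

section OfPartialGroup

open PartialGroup SubgroupIn

variable {L : Type*} [PartialGroup L]

/-- The fusion system `F_S(L)`, generated by the conjugation maps `c_g : P → Q`, `x ↦ x ^ g`, where
`P` and `Q` are subgroups of `S` and `g ∈ L` is such that `P ^ g` is defined and contained
in `Q`. -/
def ofPartialGroup (S : SubgroupIn L) : FusionSystem S :=
  generate fun P Q => {φ | ∃ g : L, ∀ x : P,
    ((x : S) : L) ∈ conjDom g ∧ (((φ x : Q) : S) : L) = conj ((x : S) : L) g}

end OfPartialGroup

end FusionSystem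

/-!
In a locality, the set `S_g` of all `x ∈ S` whose conjugate `x ^ g` is defined and lies in `S` is a
subgroup of `S` belonging to `Δ`, and conjugation by `g` is a homomorphism on it
(`IsLocality.source`, `IsLocality.conj_mul`). Hence the morphisms of `F_S(L)` are exactly the
restrictions of composites of conjugations (`IsLocality.mem_hom_iff`), and on an object such a
composite is conjugation by a single element (`IsLocality.exists_moves_of_carry`).

If `L = N_L(Q)`, then `Q ≤ S_g` for all `g`. So if a composite of conjugations is defined on `P`, it
is defined on `PQ`, and it maps `Q` onto `Q`; it is the identity on `Q` if `L = C_L(Q)`. This gives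
the required extensions.

Conversely, let `Q` be normal in `F_S(L)`. That every `g` conjugating an object `P` to an object
normalizes `Q` is shown by downward induction on `|P|` (`IsLocality.mem_normalizer_of_isNormal`).
The map induced by `g` on `P` extends to `PQ`, and the extension is conjugation by some `f` in
`N_L(Q)`. Then `g f⁻¹` lies in `C_L(P)`, and it is enough to show that `C_L(P) ≤ N_L(Q)`. Choose a
Sylow `p`-subgroup `V` of `N_L(P)` that contains `N_S(P)`. Every `p`-subgroup of the normalizer of
an object is conjugate into `S` (`IsLocality.exists_conj_into`), so `V ^ a ≤ S` for some `a`. By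
induction, applied to the object `N_S(P)`, the element `a` normalizes `Q`, so `P` may be replaced by
`P ^ a`. Thus `Y = O_p(N_L(P))` may be assumed to lie in `S`. If `Y > P`, then `Y` is an object
normalized by `C_L(P)`, and induction applies. If `Y = P`, then `C_L(P) ≤ Y ≤ S ≤ N_L(Q)`, because
`N_L(P)` is of characteristic `p`.

If `Q ≤ Z(F)`, then `Z(F)` is normal in `F`, so `Z(F) ≤ S_g` for all `g`. The extension of
`c_g : S_g → S` that is the identity on `Z(F)` is `c_g` itself, hence `g` centralizes `Q`.
-/

/-! ### Conjugation in partial groups -/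

namespace PartialGroup

variable {L : Type*} [PartialGroup L]

theorem one_mem_conjDom (x : L) : x ∈ conjDom (prod [] : L) ∧ conj x (prod [] : L) = x := by
  have hi : inv (prod [] : L) = prod [] := by
    have h := prod_inv_word ([] : List L) (left_mem [] [x] (single_mem x))
    simpa using h.symm
  have h1 := prod_one_cons _ (single_mem x)
  have h2 := prod_one_cons _ (inv_append_mem _ h1.1)
  have h3 := contract_mem [x] [] [] (by simpa using single_mem x)
  have h4 := prod_contract [x] [] [] (by simpa using single_mem x)
  simp only [List.append_nil, List.singleton_append, prod_single] at h3 h4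
  have h5 := prod_one_cons _ h3
  refine ⟨?_, ?_⟩
  · simpa [conjDom, hi] using h5.1
  · rw [conj, hi, h5.2, ← h4]

/-- Conjugating by `f` and then by `g` is conjugating by `f g`, for elements `x` such that the
word `(g⁻¹, f⁻¹, x, f, g)` has a product. -/
theorem conj_prod_pair {x f g : L} (hd : [inv g, inv f, x, f, g] ∈ (dom : Set (List L))) :
    x ∈ conjDom (prod [f, g]) ∧ conj x (prod [f, g]) = conj (conj x f) g := by
  have hfg : [f, g] ∈ (dom : Set (List L)) := right_mem [inv g, inv f, x] [f, g] hd
  have h1 := prod_inv_word _ hfg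
  have h2 := contract_mem [] [inv g, inv f] [x, f, g] hd
  have h3 := contract_mem [prod [inv g, inv f], x] [f, g] [] (by simpa using h2)
  have h4 := prod_contract [] [inv g, inv f] [x, f, g] hd
  have h5 := prod_contract [prod [inv g, inv f], x] [f, g] [] (by simpa using h2)
  have h6 := prod_contract [inv g] [inv f, x, f] [g] hd
  simp only [List.map_cons, List.map_nil, List.reverse_cons, List.reverse_nil, List.nil_append,
    List.cons_append, List.append_nil] at h1 h3 h4 h5 h6
  rw [h1] at h3 h4 h5
  exact ⟨h3, (h5.symm.trans h4.symm).trans h6⟩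

/-- Conjugation by `g` is multiplicative on `c` and `d` as soon as the word
`(g⁻¹, c, g, g⁻¹, d, g)` has a product. -/
theorem conj_mul_of_mem_dom {c d g : L}
    (hd : [inv g, c, g, inv g, d, g] ∈ (dom : Set (List L))) :
    prod [c, d] ∈ conjDom g ∧ conj (prod [c, d]) g = prod [conj c g, conj d g] := by
  have h1 := prod_append [inv g, c, g] [inv g, d, g] hd
  have h2 := contract_mem [inv g, c] [g, inv g] [d, g] hd
  have h3 := prod_contract [inv g, c] [g, inv g] [d, g] hd
  simp only [(pair_inv g).2, List.cons_append, List.nil_append] at h1 h2 h3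
  -- absorb the identity that replaces `(g, g⁻¹)` into `c`
  have h4 := contract_mem [inv g] [c, prod []] [d, g] h2
  have h5 := prod_contract [inv g] [c, prod []] [d, g] h2
  have h6 := prod_contract [c] [] [] (by simpa using single_mem c)
  simp only [List.cons_append, List.nil_append, List.append_nil, prod_single] at h4 h5 h6
  rw [← h6] at h4 h5
  have h7 := contract_mem [inv g] [c, d] [g] h4
  have h8 := prod_contract [inv g] [c, d] [g] h4
  simp only [List.cons_append, List.nil_append] at h7 h8
  refine ⟨h7, ?_⟩
  rw [conj, ← h8, ← h5, ← h3, h1]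
  rfl

theorem conj_inv_of_mem_conjDom {c g : L} (h : c ∈ conjDom g) :
    inv c ∈ conjDom g ∧ conj (inv c) g = inv (conj c g) := by
  have h1 := left_mem _ _ (inv_append_mem _ h)
  have h2 := prod_inv_word _ h
  simp only [List.map_cons, List.map_nil, List.reverse_cons, List.reverse_nil, List.nil_append,
    List.cons_append, inv_inv] at h1 h2
  exact ⟨h1, h2⟩

theorem ConjTo.symm {X Y : Set L} {g : L} (h : ConjTo X g Y) : ConjTo Y (inv g) X := by
  obtain ⟨h1, rfl⟩ := h
  refine ⟨?_, ?_⟩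
  · rintro _ ⟨x, hx, rfl⟩
    exact (conj_conj_inv (h1 hx)).1
  · rw [Set.image_image]
    exact (Set.image_congr fun x hx => (conj_conj_inv (h1 hx)).2).trans (Set.image_id' X)

theorem ConjTo.mem {X Y : Set L} {g x : L} (h : ConjTo X g Y) (hx : x ∈ X) : conj x g ∈ Y :=
  h.2 ▸ ⟨x, hx, rfl⟩

theorem conj_injOn (g : L) : Set.InjOn (fun x => conj x g) (conjDom g) := fun x hx y hy h => by
  rw [← (conj_conj_inv hx).2, ← (conj_conj_inv hy).2]
  exact congrArg (fun z => conj z (inv g)) h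

end PartialGroup

/-! ### Subgroups of a partial group -/

namespace SubgroupIn

open PartialGroup

variable {L : Type*} [PartialGroup L]

theorem mul_mem (H : SubgroupIn L) {x y : L} (hx : x ∈ H) (hy : y ∈ H) : prod [x, y] ∈ H :=
  H.prod_mem _ (by simp only [List.forall_mem_cons]; exact ⟨hx, hy, by simp⟩)

theorem conj_mem (H : SubgroupIn L) {x g : L} (hx : x ∈ H) (hg : g ∈ H) : conj x g ∈ H := by
  have := (H.coe_conj ⟨x, hx⟩ ⟨g, hg⟩).2
  exact this ▸ Subtype.property _

/-- The intersection `H ∩ T`, as a subgroup of the group `H`. -/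
def inf (H T : SubgroupIn L) : Subgroup H where
  carrier := {x | x.1 ∈ T}
  mul_mem' hx hy := T.mul_mem hx hy
  one_mem' := T.prod_mem [] (by simp)
  inv_mem' hx := T.inv_mem _ hx

theorem mem_inf {H T : SubgroupIn L} {x : H} : x ∈ H.inf T ↔ x.1 ∈ T := Iff.rfl

theorem mem_toSet {H : SubgroupIn L} {K : Subgroup H} {x : L} :
    x ∈ toSet K ↔ ∃ h : x ∈ H, (⟨x, h⟩ : H) ∈ K := by
  constructor
  · rintro ⟨y, hy, rfl⟩
    exact ⟨y.2, hy⟩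
  · rintro ⟨h, hx⟩
    exact ⟨_, hx, rfl⟩

theorem coe_mem_toSet {H : SubgroupIn L} {K : Subgroup H} {x : H} : x.1 ∈ toSet K ↔ x ∈ K :=
  ⟨fun h => (mem_toSet.1 h).2, fun h => ⟨x, h, rfl⟩⟩

theorem toSet_subset {H : SubgroupIn L} (K : Subgroup H) : toSet K ⊆ H := by
  rintro _ ⟨y, _, rfl⟩
  exact y.2

theorem toSet_mono {H : SubgroupIn L} {K M : Subgroup H} (h : K ≤ M) : toSet K ⊆ toSet M :=
  Set.image_mono h

theorem ncard_toSet {H : SubgroupIn L} (K : Subgroup H) : (toSet K).ncard = Nat.card K :=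
  (Set.ncard_image_of_injective _ Subtype.val_injective).trans
    (Nat.card_coe_set_eq (K : Set H)).symm

/-- A subgroup of the group `H`, regarded as a subgroup of the partial group. -/
def ofSubgroup {H : SubgroupIn L} (K : Subgroup H) : SubgroupIn L where
  carrier := toSet K
  inv_mem := by
    rintro _ ⟨x, hx, rfl⟩
    exact ⟨x⁻¹, K.inv_mem hx, rfl⟩
  word_mem w hw := H.word_mem w fun x hx => toSet_subset K (hw x hx)
  prod_mem w hw := by
    induction w with
    | nil => exact ⟨1, K.one_mem, rfl⟩
    | cons x w ih =>
      have hd : x :: w ∈ (dom : Set (List L)) :=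
        H.word_mem _ fun x hx => toSet_subset K (hw x hx)
      rw [prod_cons x w hd]
      obtain ⟨y, hy, rfl⟩ := hw x (by simp)
      obtain ⟨z, hz, hz'⟩ := ih fun x hx => hw x (by simp [hx])
      rw [← hz']
      exact ⟨y * z, K.mul_mem hy hz, rfl⟩

theorem isPGroup_ofSubgroup {p : ℕ} {H : SubgroupIn L} {K : Subgroup H} (hK : IsPGroup p K) :
    IsPGroup p (ofSubgroup K) := by
  let φ : K →* ofSubgroup K :=
    { toFun := fun x => ⟨x.1.1, coe_mem_toSet.2 x.2⟩
      map_one' := rfl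
      map_mul' := fun _ _ => rfl }
  refine hK.of_surjective φ ?_
  rintro ⟨_, y, hy, rfl⟩
  exact ⟨⟨y, hy⟩, rfl⟩

theorem isPGroup_of_toSet_subset {p : ℕ} {H T : SubgroupIn L} (hT : IsPGroup p T)
    {K : Subgroup H} (h : toSet K ⊆ T) : IsPGroup p K := by
  let φ : K →* T :=
    { toFun := fun x => ⟨x.1.1, h (coe_mem_toSet.2 x.2)⟩
      map_one' := rfl
      map_mul' := fun _ _ => rfl }
  refine hT.of_injective φ fun x y hxy => ?_
  exact Subtype.ext (Subtype.ext (congrArg (Subtype.val : T → L) hxy))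

end SubgroupIn

/-! ### Conjugation between objects of a locality -/

section Moves

open PartialGroup SubgroupIn

variable {L : Type*} [PartialGroup L] {S : SubgroupIn L} {p : ℕ} {Δ : Set (Subgroup S)}

/-- `P` and `P'` are objects, and `P ^ a` is defined and equals `P'`. -/
def Moves (Δ : Set (Subgroup S)) (P : Subgroup S) (a : L) (P' : Subgroup S) : Prop :=
  P ∈ Δ ∧ P' ∈ Δ ∧ ConjTo (toSet P) a (toSet P')

theorem Moves.symm {P P' : Subgroup S} {a : L} (h : Moves Δ P a P') : Moves Δ P' (inv a) P :=
  ⟨h.2.1, h.1, h.2.2.symm⟩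

theorem Moves.via {P P' : Subgroup S} {a : L} (h : Moves Δ P a P') {w : List L}
    (hw : Via Δ P' w) : Via Δ P (a :: w) :=
  ⟨h.1, P', h.2.2, hw⟩

theorem Moves.card_eq {P P' : Subgroup S} {a : L} (h : Moves Δ P a P') :
    Nat.card P' = Nat.card P := by
  rw [← ncard_toSet, ← ncard_toSet, ← h.2.2.2]
  exact Set.InjOn.ncard_image ((conj_injOn a).mono h.2.2.1)

theorem moves_of_mem_normalizer {P : Subgroup S} (hP : P ∈ Δ) {x : L}
    (hx : x ∈ PartialGroup.normalizer (toSet P)) : Moves Δ P x P := ⟨hP, hP, hx⟩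

theorem mem_normalizer_of_mem {P : Subgroup S} {x : S} (hx : x ∈ P) :
    x.1 ∈ PartialGroup.normalizer (toSet P) :=
  toSet_subset_normalizer P (coe_mem_toSet.2 hx)

namespace IsLocality

theorem mem_dom_of_via (hL : IsLocality p Δ) {P : Subgroup S} {w : List L} (h : Via Δ P w) :
    w ∈ (dom : Set (List L)) := (hL.mem_dom_iff w).2 ⟨P, h⟩

theorem moves_of_image_subset (hL : IsLocality p Δ) {P : Subgroup S} (hP : P ∈ Δ) {g : L}
    (h1 : toSet P ⊆ conjDom g) (h2 : ∀ x ∈ toSet P, conj x g ∈ S) :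
    ∃ P', Moves Δ P g P' := by
  obtain ⟨Q, hQ, h⟩ := hL.conj_closed P hP g h1 (by rintro _ ⟨x, hx, rfl⟩; exact h2 x hx)
  exact ⟨Q, hP, hQ, h1, h.symm⟩

theorem exists_moves_of_mem (hL : IsLocality p Δ) {P : Subgroup S} (hP : P ∈ Δ) {s : L}
    (hs : s ∈ S) : ∃ P', Moves Δ P s P' :=
  hL.moves_of_image_subset hP
    (fun _ hx => (S.coe_conj ⟨_, toSet_subset P hx⟩ ⟨s, hs⟩).1)
    (fun _ hx => S.conj_mem (toSet_subset P hx) hs)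

theorem exists_moves (hL : IsLocality p Δ) (g : L) : ∃ P P', Moves Δ P g P' := by
  obtain ⟨P, hP, P', hPP', hP'⟩ := (hL.mem_dom_iff [g]).1 (single_mem g)
  exact ⟨P, P', hP, hP', hPP'⟩

theorem conj_mul_of_moves (hL : IsLocality p Δ) {P P' P₁ P₁' P₂ P₂' : Subgroup S} {c d g : L}
    (h : Moves Δ P g P') (hc : Moves Δ P c P₁) (h₁ : Moves Δ P₁ g P₁') (hd : Moves Δ P₁ d P₂)
    (h₂ : Moves Δ P₂ g P₂') :
    prod [c, d] ∈ conjDom g ∧ conj (prod [c, d]) g = prod [conj c g, conj d g] :=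
  conj_mul_of_mem_dom (hL.mem_dom_of_via
    (h.symm.via (hc.via (h₁.via (h₁.symm.via (hd.via (h₂.via h₂.2.1)))))))

/-- Elements of the normalizer of an object `P` may be conjugated by composites of conjugations
starting at `P`. -/
theorem conj_conj_of_moves (hL : IsLocality p Δ) {P P' P'' : Subgroup S} {f g : L}
    (h : Moves Δ P f P') (h' : Moves Δ P' g P'') {x : L}
    (hx : x ∈ PartialGroup.normalizer (toSet P)) :
    x ∈ conjDom (prod [f, g]) ∧ conj x (prod [f, g]) = conj (conj x f) g :=
  conj_prod_pair (hL.mem_dom_of_via (h'.symm.via (h.symm.via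
    ((moves_of_mem_normalizer h.1 hx).via (h.via (h'.via h'.2.1))))))

theorem moves_mul (hL : IsLocality p Δ) {P P' P'' : Subgroup S} {f g : L}
    (h : Moves Δ P f P') (h' : Moves Δ P' g P'') : Moves Δ P (prod [f, g]) P'' := by
  have key := fun x (hx : x ∈ toSet P) =>
    hL.conj_conj_of_moves h h' (toSet_subset_normalizer P hx)
  refine ⟨h.1, h'.2.1, fun x hx => (key x hx).1, ?_⟩
  rw [Set.image_congr fun x hx => (key x hx).2, ← h'.2.2.2, ← h.2.2.2, Set.image_image]

theorem mem_conjDom_of_mem_normalizer (hL : IsLocality p Δ) {P P' : Subgroup S} {a x : L}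
    (h : Moves Δ P a P') (hx : x ∈ PartialGroup.normalizer (toSet P)) : x ∈ conjDom a :=
  hL.mem_dom_of_via (h.symm.via ((moves_of_mem_normalizer h.1 hx).via (h.via h.2.1)))

theorem conj_mem_normalizer (hL : IsLocality p Δ) {P P' : Subgroup S} {a x : L}
    (h : Moves Δ P a P') (hx : x ∈ PartialGroup.normalizer (toSet P)) :
    conj x a ∈ PartialGroup.normalizer (toSet P') := by
  have h1 := hL.moves_mul (hL.moves_mul h.symm (moves_of_mem_normalizer h.1 hx)) h
  have h2 := prod_append [inv a, x] [a] (hL.mem_conjDom_of_mem_normalizer h hx)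
  rw [prod_single] at h2
  rw [← h2] at h1
  exact h1.2.2

/-- If `P ^ a = P'` for objects `P` and `P'`, then conjugation by `a` is an isomorphism between
their normalizers. -/
def normalizerEquiv (hL : IsLocality p Δ) {P P' : Subgroup S} {a : L} (h : Moves Δ P a P') :
    hL.normalizerSubgroup h.1 ≃* hL.normalizerSubgroup h.2.1 where
  toFun x := ⟨conj x.1 a, hL.conj_mem_normalizer h x.2⟩
  invFun x := ⟨conj x.1 (inv a), hL.conj_mem_normalizer h.symm x.2⟩
  left_inv x := Subtype.ext (conj_conj_inv (hL.mem_conjDom_of_mem_normalizer h x.2)).2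
  right_inv x := Subtype.ext (by
    have := (conj_conj_inv (hL.mem_conjDom_of_mem_normalizer h.symm x.2)).2
    rwa [PartialGroup.inv_inv] at this)
  map_mul' x y := Subtype.ext (hL.conj_mul_of_moves h (moves_of_mem_normalizer h.1 x.2) h
    (moves_of_mem_normalizer h.1 y.2) h).2

/-- If `a` lies in `S_g` and `g` moves the object `P`, then `g` also moves the object `P ^ a`. This is
what makes `S_g` closed under products. -/
theorem exists_moves_conj (hL : IsLocality p Δ) {P P' : Subgroup S} {a g : L}
    (h : Moves Δ P g P') (ha : a ∈ S) (had : a ∈ conjDom g) (hag : conj a g ∈ S) :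
    ∃ P₁ P₁', Moves Δ P a P₁ ∧ Moves Δ P₁ g P₁' := by
  obtain ⟨P₁, h1⟩ := hL.exists_moves_of_mem h.1 ha
  obtain ⟨P₁', h2⟩ := hL.exists_moves_of_mem h.2.1 hag
  refine ⟨P₁, P₁', h1, ?_⟩
  -- with `b = a ^ g`, the element `g` is the product of `(a⁻¹, g, b)`, which moves `P ^ a`
  have h3 := hL.moves_mul (hL.moves_mul h1.symm h) h2
  have d1 : [inv a, g, conj a g] ∈ (dom : Set (List L)) :=
    hL.mem_dom_of_via (h1.symm.via (h.via (h2.via h2.2.1)))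
  have e1 := prod_append [inv a, g] [conj a g] d1
  have d2 : [inv a, g, inv g, a, g] ∈ (dom : Set (List L)) := by
    have hw : [inv g, a, g] ∈ (dom : Set (List L)) := had
    obtain ⟨R, hR, R', hRR', hw'⟩ := (hL.mem_dom_iff _).1 hw
    obtain ⟨hR', R₁, hR₁, hR₁', R₂, hR₂, hR₃⟩ := hw'
    have m1 : Moves Δ R' a R₁ := ⟨hR', hR₁', hR₁⟩
    have m2 : Moves Δ R (inv g) R' := ⟨hR, hR', hRR'⟩
    have m3 : Moves Δ R' g R := by simpa [PartialGroup.inv_inv] using m2.symm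
    exact hL.mem_dom_of_via
      (m1.symm.via (m3.via (m2.via (m1.via (Moves.via ⟨hR₁', hR₃, hR₂⟩ hR₃)))))
  have e2 := prod_contract [inv a, g] [inv g, a, g] [] (by simpa using d2)
  have d3 := contract_mem [inv a] [g, inv g] [a, g] d2
  have e3 := prod_contract [inv a] [g, inv g] [a, g] d2
  have d4 := contract_mem [] [inv a, prod []] [a, g] (by simpa [(pair_inv g).2] using d3)
  have e4 := prod_contract [] [inv a, prod []] [a, g] (by simpa [(pair_inv g).2] using d3)
  have e5 := prod_contract [inv a] [] [] (by simpa using single_mem (inv a))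
  simp only [(pair_inv g).2, List.cons_append, List.nil_append, List.append_nil, prod_single]
    at e1 e2 e3 d4 e4 e5
  rw [← e5] at d4 e4
  have e6 := prod_contract [] [inv a, a] [g] d4
  have e7 : prod [inv a, a] = (prod [] : L) := prod_inv_append _ (single_mem a)
  have e8 := (prod_one_cons _ (single_mem g)).2
  simp only [e7, List.cons_append, List.nil_append] at e6
  have e9 : prod [inv a, g, conj a g] = g := by
    refine e2.symm.trans (e3.trans (e4.trans (e6.trans (e8.trans (prod_single g)))))
  rw [← e1, e9] at h3
  exact h3

/-- The subgroup `S_g` of all `x ∈ S` for which `x ^ g` is defined and lies in `S`. -/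
def source (hL : IsLocality p Δ) (g : L) : Subgroup S where
  carrier := {x | x.1 ∈ conjDom g ∧ conj x.1 g ∈ S}
  mul_mem' := by
    rintro c d ⟨hc, hc'⟩ ⟨hd, hd'⟩
    obtain ⟨P, P', h⟩ := hL.exists_moves g
    obtain ⟨P₁, P₁', h1, h1'⟩ := hL.exists_moves_conj h c.2 hc hc'
    obtain ⟨P₂, P₂', h2, h2'⟩ := hL.exists_moves_conj h1' d.2 hd hd'
    have := hL.conj_mul_of_moves h h1 h1' h2 h2'
    exact ⟨this.1, this.2 ▸ S.mul_mem hc' hd'⟩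
  one_mem' := by
    obtain ⟨P, P', h⟩ := hL.exists_moves g
    have h1 : prod [] ∈ toSet P := ⟨1, P.one_mem, rfl⟩
    exact ⟨h.2.2.1 h1, toSet_subset P' (h.2.2.mem h1)⟩
  inv_mem' := by
    rintro c ⟨hc, hc'⟩
    have := conj_inv_of_mem_conjDom hc
    exact ⟨this.1, this.2 ▸ S.inv_mem _ hc'⟩

theorem conj_mul (hL : IsLocality p Δ) {g : L} {c d : S} (hc : c ∈ hL.source g)
    (hd : d ∈ hL.source g) : conj (c * d : S).1 g = prod [conj c.1 g, conj d.1 g] := by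
  obtain ⟨P, P', h⟩ := hL.exists_moves g
  obtain ⟨P₁, P₁', h1, h1'⟩ := hL.exists_moves_conj h c.2 hc.1 hc.2
  obtain ⟨P₂, P₂', h2, h2'⟩ := hL.exists_moves_conj h1' d.2 hd.1 hd.2
  exact (hL.conj_mul_of_moves h h1 h1' h2 h2').2

theorem _root_.Moves.le_source (hL : IsLocality p Δ) {P P' : Subgroup S} {g : L}
    (h : Moves Δ P g P') : P ≤ hL.source g := fun _ hx =>
  ⟨h.2.2.1 (coe_mem_toSet.2 hx), toSet_subset P' (h.2.2.mem (coe_mem_toSet.2 hx))⟩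

theorem source_mem (hL : IsLocality p Δ) (g : L) : hL.source g ∈ Δ := by
  obtain ⟨P, P', h⟩ := hL.exists_moves g
  exact hL.overgroup_closed P h.1 _ (h.le_source hL)

theorem exists_moves_of_le_source (hL : IsLocality p Δ) {P : Subgroup S} (hP : P ∈ Δ) {g : L}
    (h : P ≤ hL.source g) : ∃ P', Moves Δ P g P' := by
  refine hL.moves_of_image_subset hP ?_ ?_ <;> rintro _ ⟨x, hx, rfl⟩
  exacts [(h hx).1, (h hx).2]

end IsLocality

end Moves

/-! ### Morphisms of the fusion system of a locality -/

section Carry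

open PartialGroup SubgroupIn

variable {L : Type*} [PartialGroup L] {S : SubgroupIn L} {p : ℕ} {Δ : Set (Subgroup S)}

/-- Starting with `x ∈ S`, the successive conjugations by the letters of the word are defined, stay
in `S` and lead to `y`. -/
def Carry (S : SubgroupIn L) : List L → S → S → Prop
  | [], x, y => x = y
  | g :: w, x, y => x.1 ∈ conjDom g ∧ ∃ z : S, z.1 = conj x.1 g ∧ Carry S w z y

theorem Carry.append {u v : List L} {x y z : S} (h : Carry S u x y) (h' : Carry S v y z) :
    Carry S (u ++ v) x z := by
  induction u generalizing x with
  | nil => exact (show x = y from h) ▸ h'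
  | cons g u ih =>
    obtain ⟨h1, t, h2, h3⟩ := h
    exact ⟨h1, t, h2, ih h3⟩

theorem Carry.unique {w : List L} {x y y' : S} (h : Carry S w x y) (h' : Carry S w x y') :
    y = y' := by
  induction w generalizing x with
  | nil => exact (show x = y from h).symm.trans h'
  | cons g w ih =>
    obtain ⟨_, z, h2, h3⟩ := h
    obtain ⟨_, z', h2', h3'⟩ := h'
    obtain rfl : z = z' := Subtype.ext (h2.trans h2'.symm)
    exact ih h3 h3'

theorem Carry.reverse {w : List L} {x y : S} (h : Carry S w x y) :
    Carry S (w.map inv).reverse y x := by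
  induction w generalizing x with
  | nil => exact (show x = y from h).symm
  | cons g w ih =>
    obtain ⟨h1, z, h2, h3⟩ := h
    have h4 := conj_conj_inv h1
    simp only [List.map_cons, List.reverse_cons]
    exact (ih h3).append ⟨h2 ▸ h4.1, x, by rw [h2, h4.2], rfl⟩

theorem Carry.injective {w : List L} {x x' y : S} (h : Carry S w x y) (h' : Carry S w x' y) :
    x = x' := h.reverse.unique h'.reverse

theorem Carry.of_mem (x s : S) : Carry S [s.1] x (s⁻¹ * x * s) :=
  ⟨(S.coe_conj x s).1, _, (S.coe_conj x s).2.symm, rfl⟩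

theorem Carry.inv {w : List L} {x y : S} (h : Carry S w x y) :
    Carry S w x⁻¹ y⁻¹ := by
  induction w generalizing x with
  | nil => exact congrArg _ h
  | cons g w ih =>
    obtain ⟨h1, z, h2, h3⟩ := h
    have h4 := conj_inv_of_mem_conjDom h1
    exact ⟨h4.1, z⁻¹, by rw [coe_inv, coe_inv, h4.2, h2], ih h3⟩

namespace IsLocality

theorem carry_mul (hL : IsLocality p Δ) {w : List L} {x y x' y' : S} (h : Carry S w x y)
    (h' : Carry S w x' y') : Carry S w (x * x') (y * y') := by
  induction w generalizing x x' with
  | nil => exact congrArg₂ (· * ·) h h'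
  | cons g w ih =>
    obtain ⟨h1, z, h2, h3⟩ := h
    obtain ⟨h1', z', h2', h3'⟩ := h'
    have m : x ∈ hL.source g := ⟨h1, h2 ▸ z.2⟩
    have m' : x' ∈ hL.source g := ⟨h1', h2' ▸ z'.2⟩
    refine ⟨((hL.source g).mul_mem m m').1, z * z', ?_, ih h3 h3'⟩
    rw [hL.conj_mul m m', ← h2, ← h2', coe_mul]

theorem carry_one (hL : IsLocality p Δ) (w : List L) : Carry S w 1 1 := by
  induction w with
  | nil => rfl
  | cons g w ih =>
    have h := (hL.source g).one_mem
    refine ⟨h.1, 1, ?_, ih⟩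
    have h1 := hL.conj_mul h h
    rw [mul_one] at h1
    have h2 : (⟨_, h.2⟩ : S) = ⟨_, h.2⟩ * ⟨_, h.2⟩ := Subtype.ext h1
    exact congrArg Subtype.val (left_eq_mul.1 h2).symm

/-- The subgroup of the elements of `S` that the word `w` conjugates into `Y`. -/
def carryComap (hL : IsLocality p Δ) (w : List L) (Y : Subgroup S) : Subgroup S where
  carrier := {x | ∃ y ∈ Y, Carry S w x y}
  mul_mem' := by
    rintro _ _ ⟨y, hy, h⟩ ⟨y', hy', h'⟩
    exact ⟨_, Y.mul_mem hy hy', hL.carry_mul h h'⟩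
  one_mem' := ⟨1, Y.one_mem, hL.carry_one w⟩
  inv_mem' := by
    rintro _ ⟨y, hy, h⟩
    exact ⟨_, Y.inv_mem hy, h.inv⟩

theorem exists_hom_of_le_carryComap (hL : IsLocality p Δ) {w : List L} {X Y : Subgroup S}
    (h : X ≤ hL.carryComap w Y) : ∃ φ : X →* Y, ∀ x : X, Carry S w x (φ x) := by
  choose f hf using fun x : X => h x.2
  refine ⟨MonoidHom.mk' (fun x => ⟨f x, (hf x).1⟩) fun x y => Subtype.ext ?_, fun x => (hf x).2⟩
  exact (hf (x * y)).2.unique (hL.carry_mul (hf x).2 (hf y).2)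

theorem mem_hom_of_carry (hL : IsLocality p Δ) {w : List L} {P R : Subgroup S} (φ : P →* R)
    (h : ∀ x : P, Carry S w x (φ x)) : φ ∈ (FusionSystem.ofPartialGroup S).Hom P R := by
  induction w generalizing P with
  | nil => exact FusionSystem.conj_mem _ _ 1 fun x => by simpa using (h x).symm
  | cons g w ih =>
    have hP : P ≤ hL.carryComap [g] ⊤ := fun x hx => by
      obtain ⟨h1, z, h2, h3⟩ := h ⟨x, hx⟩
      exact ⟨z, trivial, h1, z, h2, rfl⟩
    obtain ⟨χ, hχ⟩ := hL.exists_hom_of_le_carryComap hP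
    -- factor `φ` through the image `P ^ g`
    let α : P →* S := (Subgroup.subtype ⊤).comp χ
    have hα : ∀ x : P, Carry S [g] x (α x) := hχ
    have hinj : Function.Injective α := fun x y hxy =>
      Subtype.ext ((hα x).injective (hxy ▸ hα y))
    let e : P ≃* α.range := MonoidHom.ofInjective hinj
    have he : ∀ x, ((e x : α.range) : S) = α x := fun _ => rfl
    have hφ : φ = (φ.comp e.symm.toMonoidHom).comp e.toMonoidHom := by ext; simp
    rw [hφ]
    refine FusionSystem.comp_mem _ _ _ ⟨e.injective, fun E hE => hE _ _ ⟨g, fun x => ?_⟩⟩ (ih _ ?_)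
    · obtain ⟨h1, z, h2, h3⟩ := hα x
      refine ⟨h1, ?_⟩
      rw [← h2, show z = α x from h3]
      rfl
    · intro y
      obtain ⟨x, rfl⟩ := e.surjective y
      obtain ⟨h1, z, h2, h3⟩ := h x
      obtain ⟨_, z', h2', h3'⟩ := hα x
      have : z = e x := by
        rw [he, ← show z' = α x from h3']
        exact Subtype.ext (h2.trans h2'.symm)
      simpa [← this] using h3

theorem exists_carry_of_mem_hom {P R : Subgroup S} {φ : P →* R}
    (hφ : φ ∈ (FusionSystem.ofPartialGroup S).Hom P R) :
    ∃ w, ∀ x : P, Carry S w x (φ x) := by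
  let E : FusionSystem S :=
    { Hom := fun P R => {φ | ∃ w, ∀ x : P, Carry S w x (φ x)}
      injective := by
        rintro P R φ ⟨w, hw⟩ x y hxy
        exact Subtype.ext ((hw x).injective (hxy ▸ hw y))
      conj_mem := by
        intro P R φ s h
        exact ⟨[s.1], fun x => h x ▸ Carry.of_mem _ _⟩
      comp_mem := by
        rintro P Q R φ ψ ⟨u, hu⟩ ⟨v, hv⟩
        exact ⟨u ++ v, fun x => (hu x).append (hv (φ x))⟩
      factor_mem := by
        rintro P Q R hR α ⟨w, hw⟩
        refine ⟨⟨w, hw⟩, (w.map inv).reverse, fun x => ?_⟩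
        have := (hw (α.symm x)).reverse
        simpa using this }
  refine hφ.2 E fun A B φ hφ => ?_
  obtain ⟨g, hg⟩ := hφ
  exact ⟨[g], fun x => ⟨(hg x).1, _, (hg x).2, rfl⟩⟩

/-- The morphisms of `F_S(L)` are the restrictions of composites of conjugations. -/
theorem mem_hom_iff (hL : IsLocality p Δ) {P R : Subgroup S} {φ : P →* R} :
    φ ∈ (FusionSystem.ofPartialGroup S).Hom P R ↔ ∃ w, ∀ x : P, Carry S w x (φ x) :=
  ⟨exists_carry_of_mem_hom, fun ⟨_, h⟩ => hL.mem_hom_of_carry φ h⟩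

/-- On an object, a composite of conjugations is a single conjugation. -/
theorem exists_moves_of_carry (hL : IsLocality p Δ) {w : List L} {P : Subgroup S} (hP : P ∈ Δ)
    (h : P ≤ hL.carryComap w ⊤) :
    ∃ f P', Moves Δ P f P' ∧ ∀ x ∈ P, ∀ y, Carry S w x y → y.1 = conj x.1 f := by
  induction w generalizing P with
  | nil =>
    refine ⟨(1 : S).1, P, moves_of_mem_normalizer hP (mem_normalizer_of_mem P.one_mem), ?_⟩
    rintro x - y h
    rw [coe_one, (one_mem_conjDom x.1).2, show x = y from h]
  | cons g w ih =>
    have hg : P ≤ hL.source g := fun x hx => by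
      obtain ⟨y, -, h1, z, h2, h3⟩ := h hx
      exact ⟨h1, h2 ▸ z.2⟩
    obtain ⟨P₁, h1⟩ := hL.exists_moves_of_le_source hP hg
    obtain ⟨f, P', h2, h3⟩ := ih h1.2.1 (by
      intro x hx
      obtain ⟨x', hx', he⟩ : x.1 ∈ (fun x => conj x g) '' toSet P := by
        rw [h1.2.2.2]
        exact coe_mem_toSet.2 hx
      obtain ⟨t, ht, rfl⟩ := hx'
      obtain ⟨y, hy, -, z, h2, h3⟩ := h ht
      obtain rfl : z = x := Subtype.ext (h2.trans he)
      exact ⟨y, hy, h3⟩)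
    refine ⟨_, P', hL.moves_mul h1 h2, ?_⟩
    rintro x hx y ⟨_, z, h4, h5⟩
    have h6 := h1.2.2.mem (coe_mem_toSet.2 hx)
    rw [(hL.conj_conj_of_moves h1 h2 (mem_normalizer_of_mem hx)).2, ← h4]
    exact h3 z (coe_mem_toSet.1 (by rwa [h4])) y h5

end IsLocality

end Carry

/-! ### Conjugating `p`-subgroups into `S` -/

section Sylow

open PartialGroup SubgroupIn

variable {L : Type*} [PartialGroup L] {S : SubgroupIn L} {p : ℕ} {Δ : Set (Subgroup S)}

/-- In a finite `p`-group `T`, a subgroup `T ∩ U` of `T` different from `T` is properly contained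
in a subgroup of `T` that normalizes it. -/
theorem SubgroupIn.exists_normalizing (hp : p.Prime) {T U : SubgroupIn L} [Finite L]
    (hT : IsPGroup p T) (hU : ¬ (T : Set L) ⊆ U) :
    ∃ K : Subgroup T, T.inf U < K ∧
      ∀ g ∈ K, ∀ x ∈ T.inf U, g⁻¹ * x * g ∈ T.inf U := by
  have : Fact p.Prime := ⟨hp⟩
  have : Finite T := Subtype.finite
  have := hT.isNilpotent
  refine ⟨_, Group.normalizerCondition_of_isNilpotent (T.inf U) ?_, fun g hg x hx => ?_⟩
  · rw [lt_top_iff_ne_top]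
    intro h
    exact hU fun x hx => mem_inf.1 (h ▸ Subgroup.mem_top (⟨x, hx⟩ : T))
  · have := (Subgroup.mem_normalizer_iff.1 (Subgroup.inv_mem _ hg) x).1 hx
    simpa using this

theorem PartialGroup.mem_normalizer_of_conj_mem [Finite L] {X : Set L} {g : L}
    (h : X ⊆ conjDom g) (h' : ∀ x ∈ X, conj x g ∈ X) : g ∈ PartialGroup.normalizer X := by
  refine ⟨h, Set.eq_of_subset_of_ncard_le ?_ ?_ (Set.toFinite X)⟩
  · rintro _ ⟨x, hx, rfl⟩
    exact h' x hx
  · exact (Set.InjOn.ncard_image ((conj_injOn g).mono h)).ge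

namespace IsLocality

theorem isPGroup_normalizerSubgroup_inf (hL : IsLocality p Δ) {P : Subgroup S} (hP : P ∈ Δ) :
    IsPGroup p ((hL.normalizerSubgroup hP).inf S) := by
  refine isPGroup_of_toSet_subset hL.isPGroup ?_
  rintro _ ⟨x, hx, rfl⟩
  exact hx

/-- Normalizers grow in `S`: a proper subgroup `P` of `S` is properly contained in `N_S(P)`. -/
theorem exists_lt_normalizing (hp : p.Prime) (hL : IsLocality p Δ) {P : Subgroup S} (h : P ≠ ⊤) :
    ∃ U : Subgroup S, P < U ∧ toSet U ⊆ PartialGroup.normalizer (toSet P) := by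
  have := hL.finite
  have : Fact p.Prime := ⟨hp⟩
  have : Finite S := Subtype.finite
  have := hL.isPGroup.isNilpotent
  refine ⟨_, Group.normalizerCondition_of_isNilpotent P h.lt_top, ?_⟩
  rintro _ ⟨g, hg, rfl⟩
  refine mem_normalizer_of_conj_mem ?_ ?_ <;> rintro _ ⟨x, hx, rfl⟩
  · exact (S.coe_conj x g).1
  · rw [(S.coe_conj x g).2]
    have := (Subgroup.mem_normalizer_iff.1 (Subgroup.inv_mem _ hg) x).1 hx
    exact coe_mem_toSet.2 (by simpa using this)

/-- If `a` moves the object `R` to `R'`, then it conjugates `p`-subgroups of `N_L(R)` containing `R`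
into `p`-subgroups of `N_L(R')` containing `R'`. -/
theorem exists_conj_subgroup (hL : IsLocality p Δ) {R R' : Subgroup S} {a : L}
    (h : Moves Δ R a R') {T : SubgroupIn L} (hT : IsPGroup p T) (hRT : toSet R ⊆ T)
    (hTN : (T : Set L) ⊆ PartialGroup.normalizer (toSet R)) :
    ∃ T' : SubgroupIn L, IsPGroup p T' ∧ toSet R' ⊆ T' ∧
      (T' : Set L) ⊆ PartialGroup.normalizer (toSet R') ∧ ∀ t ∈ T, conj t a ∈ T' := by
  let e := hL.normalizerEquiv h
  let K := ((hL.normalizerSubgroup h.1).inf T).map e.toMonoidHom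
  have hK : ∀ t ∈ T, conj t a ∈ ofSubgroup K := fun t ht =>
    ⟨e ⟨t, hTN ht⟩, ⟨⟨t, hTN ht⟩, ht, rfl⟩, rfl⟩
  refine ⟨ofSubgroup K, isPGroup_ofSubgroup (IsPGroup.map ?_ _), ?_, toSet_subset K, hK⟩
  · refine isPGroup_of_toSet_subset hT ?_
    rintro _ ⟨x, hx, rfl⟩
    exact hx
  · intro y hy
    obtain ⟨x, hx, rfl⟩ := h.2.2.2.ge hy
    exact hK x (hRT hx)

/-- The inductive step for conjugating a `p`-subgroup `T` of `N_L(R)` into `S` when `T ∩ S` is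
strictly larger than `R`. Passing to `N_T(T ∩ S)` and to the object `T ∩ S`, one finds a
conjugate of `T` that meets `S` in a larger subgroup. -/
theorem exists_conj_into_of_lt (hp : p.Prime) (hL : IsLocality p Δ) {n : ℕ}
    (IH : ∀ R ∈ Δ, n < Nat.card R → ∀ T : SubgroupIn L, IsPGroup p T → toSet R ⊆ T →
      (T : Set L) ⊆ PartialGroup.normalizer (toSet R) →
      ∃ a R', Moves Δ R a R' ∧ ∀ t ∈ T, conj t a ∈ S)
    (R : Subgroup S) (hR : R ∈ Δ) (hn : Nat.card R = n) (T : SubgroupIn L) (hT : IsPGroup p T)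
    (hRT : toSet R ⊆ T) (hTN : (T : Set L) ⊆ PartialGroup.normalizer (toSet R))
    (hlt : n < Nat.card (S.inf T)) :
    ∃ a R', Moves Δ R a R' ∧ ∀ t ∈ T, conj t a ∈ S := by
  have := hL.finite
  have : Finite S := Subtype.finite
  by_cases hTS : (T : Set L) ⊆ S
  · refine ⟨(1 : S).1, R, moves_of_mem_normalizer hR (mem_normalizer_of_mem R.one_mem), ?_⟩
    intro t ht
    rw [coe_one, (one_mem_conjDom t).2]
    exact hTS ht
  obtain ⟨K, hK, hKn⟩ := exists_normalizing hp hT hTS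
  have hRT₀ : R ≤ S.inf T := fun x hx => hRT (coe_mem_toSet.2 hx)
  have hT₀ : S.inf T ∈ Δ := hL.overgroup_closed R hR _ hRT₀
  have hT₀K : toSet (S.inf T) ⊆ ofSubgroup K := by
    rintro _ ⟨x, hx, rfl⟩
    exact ⟨⟨x.1, hx⟩, hK.le x.2, rfl⟩
  obtain ⟨a, T₀', ha, haS⟩ := IH _ hT₀ hlt (ofSubgroup K)
    (isPGroup_ofSubgroup (hT.to_subgroup K)) hT₀K (by
      rintro _ ⟨g, hg, rfl⟩
      refine mem_normalizer_of_conj_mem ?_ ?_ <;> rintro _ ⟨x, hx, rfl⟩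
      · exact (T.coe_conj ⟨x.1, hx⟩ g).1
      · rw [(T.coe_conj ⟨x.1, hx⟩ g).2]
        have h1 : (⟨x.1, hx⟩ : T) ∈ T.inf S := x.2
        exact mem_toSet.2 ⟨hKn g hg _ h1, mem_inf.2 (g⁻¹ * ⟨x.1, hx⟩ * g : T).2⟩)
  obtain ⟨R', hR'⟩ := hL.exists_moves_of_le_source hR (hRT₀.trans (ha.le_source hL))
  obtain ⟨T', hT', hRT', hTN', hTT'⟩ := hL.exists_conj_subgroup hR' hT hRT hTN
  -- `T' ∩ S` contains the conjugate of `K`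
  have hcard : Nat.card (S.inf T) < Nat.card (S.inf T') := by
    have h1 : Nat.card (S.inf T) < Nat.card K := by
      rw [← ncard_toSet, ← ncard_toSet]
      refine Set.ncard_lt_ncard (hT₀K.ssubset_of_not_subset fun h => hK.not_ge fun x hx => ?_)
        (Set.toFinite _)
      exact (mem_toSet.1 (h (coe_mem_toSet.2 hx))).1
    refine h1.trans_le ?_
    have hKR : toSet K ⊆ conjDom a := fun x hx =>
      hL.mem_conjDom_of_mem_normalizer hR' (hTN (toSet_subset K hx))
    rw [← ncard_toSet, ← ncard_toSet, ← Set.InjOn.ncard_image ((conj_injOn a).mono hKR)]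
    refine Set.ncard_le_ncard ?_ (Set.toFinite _)
    rintro _ ⟨x, hx, rfl⟩
    exact mem_toSet.2 ⟨haS x hx, hTT' x (toSet_subset K hx)⟩
  have hle : Nat.card (S.inf T') ≤ Nat.card S := Subgroup.card_le_card_group _
  obtain ⟨b, R'', hb, hbS⟩ := exists_conj_into_of_lt hp hL IH R' hR'.2.1 (hR'.card_eq.trans hn)
    T' hT' hRT' hTN' (hlt.trans hcard)
  refine ⟨prod [a, b], R'', hL.moves_mul hR' hb, fun t ht => ?_⟩
  rw [(hL.conj_conj_of_moves hR' hb (hTN ht)).2]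
  exact hbS _ (hTT' t ht)
termination_by Nat.card S - Nat.card (S.inf T)

/-- Every `p`-subgroup of the normalizer of an object is conjugate to a subgroup of `S`. -/
theorem exists_conj_into (hp : p.Prime) (hL : IsLocality p Δ) (R : Subgroup S) (hR : R ∈ Δ)
    (T : SubgroupIn L) (hT : IsPGroup p T) (hRT : toSet R ⊆ T)
    (hTN : (T : Set L) ⊆ PartialGroup.normalizer (toSet R)) :
    ∃ a R', Moves Δ R a R' ∧ ∀ t ∈ T, conj t a ∈ S := by
  have := hL.finite
  have : Fact p.Prime := ⟨hp⟩
  have : Finite S := Subtype.finite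
  induction hm : Nat.card S - Nat.card R using Nat.strong_induction_on generalizing R T with
  | _ m ih =>
  by_cases hRtop : R = ⊤
  · have hST : (S : Set L) ⊆ T := fun x hx => hRT (mem_toSet.2 ⟨hx, hRtop ▸ trivial⟩)
    refine ⟨(1 : S).1, R, moves_of_mem_normalizer hR (mem_normalizer_of_mem R.one_mem), ?_⟩
    intro t ht
    rw [coe_one, (one_mem_conjDom t).2]
    exact hL.maximal T hT hST ▸ ht
  have IH : ∀ R₁ ∈ Δ, Nat.card R < Nat.card R₁ → ∀ T : SubgroupIn L, IsPGroup p T →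
      toSet R₁ ⊆ T → (T : Set L) ⊆ PartialGroup.normalizer (toSet R₁) →
      ∃ a R', Moves Δ R₁ a R' ∧ ∀ t ∈ T, conj t a ∈ S := by
    intro R₁ hR₁ hlt T hT hRT hTN
    have : Nat.card R₁ ≤ Nat.card S := Subgroup.card_le_card_group _
    exact ih _ (by omega) R₁ hR₁ T hT hRT hTN rfl
  let N := hL.normalizerSubgroup hR
  have : Finite N := Subtype.finite
  obtain ⟨U, hRU, hUN⟩ := exists_lt_normalizing hp hL hRtop
  obtain ⟨V, hV⟩ := (hL.isPGroup_normalizerSubgroup_inf hR).exists_le_sylow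
  have hUV : toSet U ⊆ ofSubgroup (V : Subgroup N) := fun x hx =>
    mem_toSet.2 ⟨hUN hx, hV (toSet_subset U hx)⟩
  obtain ⟨a, R', ha, haS⟩ := exists_conj_into_of_lt hp hL IH R hR rfl (ofSubgroup (V : Subgroup N))
    (isPGroup_ofSubgroup V.isPGroup') ((toSet_mono hRU.le).trans hUV) (toSet_subset _) (by
      refine (?_ : Nat.card R < Nat.card U).trans_le
        (Subgroup.card_le_of_le fun x hx => hUV (coe_mem_toSet.2 hx))
      exact lt_of_not_ge fun h => hRU.ne (Subgroup.eq_of_le_of_card_ge hRU.le h))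
  -- by Sylow's theorem, `T` is conjugate in `N_L(R)` to a subgroup of `V`
  have hTp : IsPGroup p (N.inf T) := isPGroup_of_toSet_subset hT (by
    rintro _ ⟨x, hx, rfl⟩
    exact hx)
  obtain ⟨W, hW⟩ := hTp.exists_le_sylow
  obtain ⟨b, hb⟩ := MulAction.exists_smul_eq N W V
  have hb' : Moves Δ R (b⁻¹ : N).1 R := moves_of_mem_normalizer hR (b⁻¹ : N).2
  refine ⟨_, R', hL.moves_mul hb' ha, fun t ht => ?_⟩
  rw [(hL.conj_conj_of_moves hb' ha (hTN ht)).2]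
  refine haS _ ?_
  rw [(N.coe_conj ⟨t, hTN ht⟩ b⁻¹).2]
  refine coe_mem_toSet.2 ?_
  rw [← hb]
  have h1 : (⟨t, hTN ht⟩ : N) ∈ W := hW ht
  have h2 := Subgroup.smul_mem_pointwise_smul _ (MulAut.conj b) _ h1
  rw [_root_.inv_inv]
  exact h2

end IsLocality

end Sylow

/-! ### Normal and central subgroups of the fusion system -/

section Main

open PartialGroup SubgroupIn

variable {L : Type*} [PartialGroup L] {S : SubgroupIn L} {p : ℕ} {Δ : Set (Subgroup S)}

theorem SubgroupIn.normal_of_subset_normalizer {Q : Subgroup S}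
    (h : (S : Set L) ⊆ PartialGroup.normalizer (toSet Q)) : Q.Normal := by
  refine ⟨fun x hx g => ?_⟩
  have h1 := (h (g⁻¹ : S).2).mem (coe_mem_toSet.2 hx)
  rw [(S.coe_conj x g⁻¹).2, _root_.inv_inv] at h1
  exact coe_mem_toSet.1 h1

theorem SubgroupIn.subset_normalizer_of_normal {Q : Subgroup S} (h : Q.Normal) :
    (S : Set L) ⊆ PartialGroup.normalizer (toSet Q) := by
  intro g hg
  refine ⟨?_, Set.Subset.antisymm ?_ ?_⟩
  · rintro _ ⟨x, hx, rfl⟩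
    exact (S.coe_conj x ⟨g, hg⟩).1
  · rintro _ ⟨_, ⟨x, hx, rfl⟩, rfl⟩
    change conj x.1 g ∈ toSet Q
    rw [show conj x.1 g = _ from (S.coe_conj x ⟨g, hg⟩).2]
    exact coe_mem_toSet.2 (by simpa using h.conj_mem x hx (⟨g, hg⟩⁻¹ : S))
  · rintro _ ⟨x, hx, rfl⟩
    refine ⟨_, coe_mem_toSet.2 (h.conj_mem x hx ⟨g, hg⟩), ?_⟩
    refine (S.coe_conj _ ⟨g, hg⟩).2.trans ?_
    simp [mul_assoc]

theorem FusionSystem.IsCentral.isNormal {G : Type*} [Group G] {F : FusionSystem G}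
    {Q : Subgroup G} (h : F.IsCentral Q) : F.IsNormal Q := by
  refine ⟨⟨fun x hx g => ?_⟩, fun P R φ hφ => ?_⟩
  · rw [Subgroup.mem_center_iff.1 (h.1 hx) g, mul_inv_cancel_right]
    exact hx
  · obtain ⟨ψ, hψ, h1, h2⟩ := h.2 P R φ hφ
    have h3 : ∀ q (hq : q ∈ Q), ψ ⟨q, le_sup_right (a := P) hq⟩ = ⟨q, le_sup_right (a := R) hq⟩ :=
      fun q hq => DFunLike.congr_fun h2 ⟨q, hq⟩
    refine ⟨ψ, hψ, h1, le_antisymm ?_ ?_⟩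
    · rintro _ ⟨x, hx, rfl⟩
      have := h3 x.1 hx
      rw [show x = ⟨x.1, _⟩ from rfl, this]
      exact hx
    · intro x hx
      exact ⟨⟨x.1, _⟩, hx, h3 x.1 hx⟩

theorem carry_of_forall_mem_normalizer {X : Set S}
    (h : ∀ g : L, g ∈ PartialGroup.normalizer (Subtype.val '' X)) (w : List L) :
    ∀ x ∈ X, ∃ y ∈ X, Carry S w x y := by
  induction w with
  | nil => exact fun x hx => ⟨x, hx, rfl⟩
  | cons g w ih =>
    intro x hx
    obtain ⟨z, hz, hz'⟩ := (h g).mem ⟨x, hx, rfl⟩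
    obtain ⟨y, hy, h1⟩ := ih z hz
    exact ⟨y, hy, (h g).1 ⟨x, hx, rfl⟩, z, hz', h1⟩

namespace IsLocality

/-- If `Q` is conjugated into itself by every word, then each morphism of the fusion system extends
to `PQ`, as a composite of the same conjugations. -/
theorem exists_extension (hL : IsLocality p Δ) {Q : Subgroup S}
    (h : ∀ w, ∀ x ∈ Q, ∃ y ∈ Q, Carry S w x y) {P R : Subgroup S} {φ : P →* R}
    (hφ : φ ∈ (FusionSystem.ofPartialGroup S).Hom P R) :
    ∃ w, ∃ ψ ∈ (FusionSystem.ofPartialGroup S).Hom (P ⊔ Q) (R ⊔ Q),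
      ψ.comp (Subgroup.inclusion le_sup_left) = (Subgroup.inclusion le_sup_left).comp φ ∧
      ∀ x : (P ⊔ Q : Subgroup S), Carry S w x (ψ x) := by
  obtain ⟨w, hw⟩ := hL.mem_hom_iff.1 hφ
  have hle : P ⊔ Q ≤ hL.carryComap w (R ⊔ Q) := by
    refine sup_le (fun x hx => ?_) fun x hx => ?_
    · exact ⟨φ ⟨x, hx⟩, Subgroup.mem_sup_left (φ ⟨x, hx⟩).2, hw ⟨x, hx⟩⟩
    · obtain ⟨y, hy, hxy⟩ := h w x hx
      exact ⟨y, Subgroup.mem_sup_right hy, hxy⟩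
  obtain ⟨ψ, hψ⟩ := hL.exists_hom_of_le_carryComap hle
  refine ⟨w, ψ, hL.mem_hom_of_carry ψ hψ, ?_, hψ⟩
  ext x
  exact congrArg Subtype.val ((hψ (Subgroup.inclusion le_sup_left x)).unique (hw x))

theorem isNormal_of_normalizer_eq_univ (hL : IsLocality p Δ) {Q : Subgroup S}
    (h : ∀ g : L, g ∈ PartialGroup.normalizer (toSet Q)) :
    (FusionSystem.ofPartialGroup S).IsNormal Q := by
  have hc := carry_of_forall_mem_normalizer (X := (Q : Set S)) h
  refine ⟨normal_of_subset_normalizer fun g _ => h g, fun P R φ hφ => ?_⟩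
  obtain ⟨w, ψ, hψ, h1, h2⟩ := hL.exists_extension hc hφ
  refine ⟨ψ, hψ, h1, le_antisymm ?_ ?_⟩
  · rintro _ ⟨x, hx, rfl⟩
    obtain ⟨y, hy, hxy⟩ := hc w x.1 hx
    exact Subgroup.mem_subgroupOf.2 ((h2 x).unique hxy ▸ hy)
  · intro y hy
    obtain ⟨x, hx, hyx⟩ := hc (w.map inv).reverse y.1 hy
    refine ⟨⟨x, Subgroup.mem_sup_right hx⟩, hx, Subtype.ext ?_⟩
    have h3 := hyx.reverse
    rw [List.map_reverse, List.reverse_reverse, List.map_map,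
      show (inv ∘ inv : L → L) = id from funext PartialGroup.inv_inv, List.map_id] at h3
    exact (h2 _).unique h3

theorem isCentral_of_centralizer_eq_univ (hL : IsLocality p Δ) {Q : Subgroup S}
    (h : ∀ g : L, g ∈ PartialGroup.centralizer (toSet Q)) :
    (FusionSystem.ofPartialGroup S).IsCentral Q := by
  have hc : ∀ w, ∀ x ∈ Q, Carry S w x x := by
    intro w
    induction w with
    | nil => exact fun x _ => rfl
    | cons g w ih =>
      intro x hx
      have := h g x (coe_mem_toSet.2 hx)
      exact ⟨this.1, x, this.2.symm, ih x hx⟩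
  refine ⟨fun x hx => Subgroup.mem_center_iff.2 fun g => ?_, fun P R φ hφ => ?_⟩
  · have h1 := (h g.1 x.1 (coe_mem_toSet.2 hx)).2
    rw [(S.coe_conj x g).2] at h1
    have h2 : g⁻¹ * x * g = x := Subtype.ext h1
    rw [mul_assoc, inv_mul_eq_iff_eq_mul] at h2
    exact h2.symm
  · obtain ⟨w, ψ, hψ, h1, h2⟩ := hL.exists_extension (fun w x hx => ⟨x, hx, hc w x hx⟩) hφ
    refine ⟨ψ, hψ, h1, ?_⟩
    ext x
    exact congrArg Subtype.val ((h2 _).unique (hc w x.1 x.2))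

/-- The conjugation map `P → P'` induced by `g`, as a morphism of the fusion system. -/
theorem exists_hom_of_moves (hL : IsLocality p Δ) {P P' : Subgroup S} {g : L}
    (h : Moves Δ P g P') :
    ∃ φ ∈ (FusionSystem.ofPartialGroup S).Hom P P', ∀ x : P, ((φ x : S) : L) = conj x.1.1 g := by
  have hle : P ≤ hL.carryComap [g] P' := fun x hx => by
    have h1 := h.2.2.mem (coe_mem_toSet.2 hx)
    exact ⟨⟨_, toSet_subset _ h1⟩, coe_mem_toSet.1 h1, h.2.2.1 (coe_mem_toSet.2 hx), _, rfl, rfl⟩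
  obtain ⟨φ, hφ⟩ := hL.exists_hom_of_le_carryComap hle
  refine ⟨φ, hL.mem_hom_of_carry φ hφ, fun x => ?_⟩
  obtain ⟨_, z, h2, h3⟩ := hφ x
  rw [← h2, show z = φ x from h3]

/-- If `Q` is normal in the fusion system and `P ^ g` is an object, then some `f ∈ N_L(Q)` induces
on the object `P` the same map as `g`, and `PQ` is conjugated by `f` to an object. -/
theorem exists_moves_sup (hL : IsLocality p Δ) {Q : Subgroup S}
    (hQ : (FusionSystem.ofPartialGroup S).IsNormal Q) {P P' : Subgroup S} {g : L}
    (h : Moves Δ P g P') :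
    ∃ f ∈ PartialGroup.normalizer (toSet Q), ∃ P₁, Moves Δ (P ⊔ Q) f P₁ ∧
      ∀ x ∈ toSet P, conj x f = conj x g := by
  obtain ⟨φ, hφ, hφg⟩ := hL.exists_hom_of_moves h
  obtain ⟨ψ, hψ, h1, h2⟩ := hQ.2 P P' φ hφ
  obtain ⟨w, hw⟩ := hL.mem_hom_iff.1 hψ
  obtain ⟨f, P₁, h3, h4⟩ := hL.exists_moves_of_carry
    (hL.overgroup_closed P h.1 _ le_sup_left) (fun x hx => ⟨_, trivial, hw ⟨x, hx⟩⟩)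
  have h5 : ∀ x : (P ⊔ Q : Subgroup S), ((ψ x : S) : L) = conj x.1.1 f := fun x =>
    h4 x.1 x.2 _ (hw x)
  refine ⟨f, ⟨(toSet_mono le_sup_right).trans h3.2.2.1, ?_⟩, P₁, h3, ?_⟩
  · ext y
    constructor
    · rintro ⟨_, ⟨x, hx, rfl⟩, rfl⟩
      have h6 : ψ ⟨x, Subgroup.mem_sup_right hx⟩ ∈ Q.subgroupOf (P' ⊔ Q) :=
        h2 ▸ ⟨⟨x, Subgroup.mem_sup_right hx⟩, hx, rfl⟩
      change conj x.1 f ∈ toSet Q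
      rw [← h5 ⟨x, Subgroup.mem_sup_right hx⟩]
      exact coe_mem_toSet.2 h6
    · rintro ⟨y, hy, rfl⟩
      have h6 : (⟨y, Subgroup.mem_sup_right hy⟩ : (P' ⊔ Q : Subgroup S)) ∈
        (Q.subgroupOf (P ⊔ Q)).map ψ := h2 ▸ hy
      obtain ⟨x, hx, hxy⟩ := h6
      exact ⟨_, coe_mem_toSet.2 hx, (h5 x).symm.trans (by rw [hxy])⟩
  · rintro _ ⟨x, hx, rfl⟩
    rw [← hφg ⟨x, hx⟩, ← h5 ⟨x, Subgroup.mem_sup_left hx⟩]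
    exact congrArg (fun t : (P' ⊔ Q : Subgroup S) => t.1.1) (DFunLike.congr_fun h1 ⟨x, hx⟩)

/-- The elements of `N_L(Q)` may be multiplied along chains of objects. -/
theorem mul_mem_normalizer_of_moves (hL : IsLocality p Δ) {Q P P' P'' : Subgroup S} {f g : L}
    (h : Moves Δ P f P') (h' : Moves Δ P' g P'')
    (hf : f ∈ PartialGroup.normalizer (toSet Q)) (hg : g ∈ PartialGroup.normalizer (toSet Q)) :
    prod [f, g] ∈ PartialGroup.normalizer (toSet Q) := by
  have hle : ∀ {A A' : Subgroup S} {k : L}, Moves Δ A k A' →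
      k ∈ PartialGroup.normalizer (toSet Q) → A ⊔ Q ≤ hL.source k := fun hm hk =>
    sup_le (hm.le_source hL) fun x hx =>
      ⟨hk.1 (coe_mem_toSet.2 hx), toSet_subset Q (hk.mem (coe_mem_toSet.2 hx))⟩
  -- enlarge the object in the middle so that it contains `Q`
  have hO : P' ⊔ Q ∈ Δ := hL.overgroup_closed P' h'.1 _ le_sup_left
  obtain ⟨B, hB⟩ := hL.exists_moves_of_le_source hO (hle h' hg)
  obtain ⟨A, hA⟩ := hL.exists_moves_of_le_source hO (hle h.symm (inv_mem_normalizer hf))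
  have hA' := hA.symm
  rw [PartialGroup.inv_inv] at hA'
  have hQA : toSet Q ⊆ toSet A := fun x hx => by
    rw [← hA.2.2.2]
    rw [← (inv_mem_normalizer hf).2] at hx
    exact Set.image_mono (toSet_mono le_sup_right) hx
  have key := fun x (hx : x ∈ toSet Q) =>
    hL.conj_conj_of_moves hA' hB (toSet_subset_normalizer A (hQA hx))
  refine ⟨fun x hx => (key x hx).1, ?_⟩
  rw [Set.image_congr fun x hx => (key x hx).2]
  conv_rhs => rw [← hg.2, ← hf.2, Set.image_image]

theorem isPGroup_pCore {G : Type*} [Group G] : IsPGroup p (pCore p G) :=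
  Sylow.sSup_of_normal _ (fun _ h => h.2) fun _ h => h.1

theorem normal_pCore {G : Type*} [Group G] : (pCore p G).Normal :=
  Subgroup.sSup_normal _ fun _ h => h.1

/-- A conjugate `P'` of the object `P` such that `O_p(N_L(P')) ≤ S`, reached by an element that
conjugates `N_S(P)` into `S`. -/
theorem exists_moves_pCore_le (hp : p.Prime) (hL : IsLocality p Δ) {P : Subgroup S} (hP : P ∈ Δ) :
    ∃ a P', ∃ h : Moves Δ P a P',
      (∀ x ∈ S, x ∈ PartialGroup.normalizer (toSet P) → x ∈ conjDom a ∧ conj x a ∈ S) ∧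
      toSet (pCore p (hL.normalizerSubgroup h.2.1)) ⊆ S := by
  have := hL.finite
  have : Fact p.Prime := ⟨hp⟩
  let N := hL.normalizerSubgroup hP
  obtain ⟨V, hV⟩ := (hL.isPGroup_normalizerSubgroup_inf hP).exists_le_sylow
  have hNV : ∀ x ∈ S, x ∈ PartialGroup.normalizer (toSet P) → x ∈ toSet (V : Subgroup N) :=
    fun x hx hxN => mem_toSet.2 ⟨hxN, hV hx⟩
  obtain ⟨a, P', h, haS⟩ := hL.exists_conj_into hp P hP (ofSubgroup (V : Subgroup N))
    (isPGroup_ofSubgroup V.isPGroup')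
    (fun x hx => hNV x (toSet_subset P hx) (toSet_subset_normalizer P hx)) (toSet_subset _)
  refine ⟨a, P', h, fun x hx hxN => ⟨hL.mem_conjDom_of_mem_normalizer h hxN,
    haS x (hNV x hx hxN)⟩, ?_⟩
  let e := hL.normalizerEquiv h
  let M := (pCore p (hL.normalizerSubgroup h.2.1)).comap e.toMonoidHom
  have hM : IsPGroup p M := isPGroup_pCore.comap_of_injective _ e.injective
  have hMn : M.Normal := normal_pCore.comap _
  -- a normal `p`-subgroup is contained in the Sylow subgroup `V`
  have hMV : M ≤ V := by
    have h1 := V.is_maximal' (hM.to_sup_of_normal_left V.isPGroup') le_sup_right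
    exact h1 ▸ le_sup_left
  rintro _ ⟨y, hy, rfl⟩
  obtain ⟨x, rfl⟩ := e.surjective y
  exact haS x.1 (coe_mem_toSet.2 (hMV hy))

theorem le_pCore (hL : IsLocality p Δ) {P : Subgroup S} (hP : P ∈ Δ) :
    toSet P ⊆ toSet (pCore p (hL.normalizerSubgroup hP)) := by
  let N := hL.normalizerSubgroup hP
  let M := N.inf (ofSubgroup P)
  have hM : M ≤ pCore p N := by
    refine le_sSup ⟨⟨fun x hx g => ?_⟩, ?_⟩
    · have h1 := (g⁻¹ : N).2.mem hx
      rwa [(N.coe_conj x g⁻¹).2, _root_.inv_inv] at h1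
    · refine isPGroup_of_toSet_subset (isPGroup_ofSubgroup (hL.isPGroup.to_subgroup P)) ?_
      rintro _ ⟨x, hx, rfl⟩
      exact hx
  exact fun x hx => mem_toSet.2 ⟨toSet_subset_normalizer P hx, hM hx⟩

/-- Suppose that `O_p(N_L(P)) ≤ S` and that the elements normalizing objects larger than `P`
normalize `Q`. Then `C_L(P) ≤ N_L(Q)`: either `O_p(N_L(P))` is a larger object, or it is `P`, and
`C_L(P) ≤ P` by the hypothesis on the characteristic. -/
theorem centralizer_subset_of_pCore_le (hL : IsLocality p Δ)
    (hchar : hL.IsOfObjectiveCharacteristic) {Q : Subgroup S}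
    (hQ : (S : Set L) ⊆ PartialGroup.normalizer (toSet Q)) {P : Subgroup S} (hP : P ∈ Δ)
    (IH : ∀ R ∈ Δ, P < R → PartialGroup.normalizer (toSet R) ⊆ PartialGroup.normalizer (toSet Q))
    (hY : toSet (pCore p (hL.normalizerSubgroup hP)) ⊆ S) {h : L} (hh : Moves Δ P h P)
    (hc : ∀ x ∈ toSet P, conj x h = x) : h ∈ PartialGroup.normalizer (toSet Q) := by
  have := hL.finite
  let N := hL.normalizerSubgroup hP
  let Y := pCore p N
  let YS : Subgroup S := S.inf (ofSubgroup Y)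
  have hYS : toSet YS = toSet Y := Set.Subset.antisymm
    (by rintro _ ⟨x, hx, rfl⟩; exact hx) fun x hx => mem_toSet.2 ⟨hY hx, hx⟩
  have hPY : P ≤ YS := fun x hx => hL.le_pCore hP (coe_mem_toSet.2 hx)
  rcases hPY.eq_or_lt with heq | hlt
  · have hmem : (⟨h, hh.2.2⟩ : N) ∈ pCore p N := by
      refine hchar P hP (Subgroup.mem_centralizer_iff.2 fun y hy => ?_)
      have h1 : y.1 ∈ toSet P := by
        exact (congrArg toSet heq).trans hYS ▸ coe_mem_toSet.2 hy
      have h2 := hc y.1 h1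
      rw [show conj y.1 h = _ from (N.coe_conj y ⟨h, hh.2.2⟩).2] at h2
      have h3 : (⟨h, hh.2.2⟩ : N)⁻¹ * y * ⟨h, hh.2.2⟩ = y := Subtype.ext h2
      rw [mul_assoc, inv_mul_eq_iff_eq_mul] at h3
      exact h3
    exact hQ (hY (coe_mem_toSet.2 hmem))
  · refine IH YS (hL.overgroup_closed P hP _ hPY) hlt ?_
    rw [hYS]
    refine mem_normalizer_of_conj_mem ?_ ?_ <;> rintro _ ⟨x, hx, rfl⟩
    · exact (N.coe_conj x ⟨h, hh.2.2⟩).1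
    · rw [show conj x.1 h = _ from (N.coe_conj x ⟨h, hh.2.2⟩).2]
      have := (normal_pCore (p := p)).conj_mem x hx (⟨h, hh.2.2⟩⁻¹ : N)
      exact coe_mem_toSet.2 (by simpa using this)

/-- If `Q` is normal in the fusion system of a locality of objective characteristic `p`, then every
element that conjugates some object to an object normalizes `Q`. -/
theorem mem_normalizer_of_isNormal (hp : p.Prime) (hL : IsLocality p Δ)
    (hchar : hL.IsOfObjectiveCharacteristic) {Q : Subgroup S}
    (hQ : (FusionSystem.ofPartialGroup S).IsNormal Q) {P P' : Subgroup S} {g : L}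
    (hg : Moves Δ P g P') : g ∈ PartialGroup.normalizer (toSet Q) := by
  have := hL.finite
  have : Finite S := Subtype.finite
  have hSQ := subset_normalizer_of_normal hQ.1
  induction hm : Nat.card S - Nat.card P using Nat.strong_induction_on generalizing P P' g with
  | _ m ih =>
  have IH : ∀ {R R' : Subgroup S} {k : L}, Nat.card P < Nat.card R → Moves Δ R k R' →
      k ∈ PartialGroup.normalizer (toSet Q) := fun {R R' k} hlt hk => by
    have : Nat.card R ≤ Nat.card S := Subgroup.card_le_card_group _
    exact ih _ (by omega) hk rfl
  have card_lt : ∀ {A B : Subgroup S}, A < B → Nat.card A < Nat.card B := fun h =>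
    lt_of_not_ge fun h' => h.ne (Subgroup.eq_of_le_of_card_ge h.le h')
  obtain ⟨f, hf, P₁, hfP₁, hfg⟩ := hL.exists_moves_sup hQ hg
  by_cases hPtop : P = ⊤
  · have hPQ : toSet Q ⊆ toSet P := toSet_mono (hPtop ▸ le_top)
    refine ⟨hPQ.trans hg.2.2.1, ?_⟩
    rw [← Set.image_congr fun x hx => hfg x (hPQ hx)]
    exact hf.2
  -- elements of `C_L(P)` normalize `Q`
  have hC : ∀ h, Moves Δ P h P → (∀ x ∈ toSet P, conj x h = x) →
      h ∈ PartialGroup.normalizer (toSet Q) := by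
    intro h hh hc
    obtain ⟨a, P', ha, haS, hY⟩ := hL.exists_moves_pCore_le hp hg.1
    obtain ⟨U, hPU, hU⟩ := exists_lt_normalizing hp hL hPtop
    obtain ⟨U', hUU'⟩ := hL.exists_moves_of_le_source (hL.overgroup_closed P hg.1 U hPU.le)
      (g := a) fun x hx => haS x.1 x.2 (hU (coe_mem_toSet.2 hx))
    have haQ := IH (card_lt hPU) hUU'
    have hh' := hL.moves_mul (hL.moves_mul ha.symm hh) ha
    have key : prod [prod [inv a, h], a] ∈ PartialGroup.normalizer (toSet Q) := by
      refine hL.centralizer_subset_of_pCore_le hchar hSQ ha.2.1 (fun R hR hlt k hk => ?_) hY hh'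
        fun y hy => ?_
      · exact IH (ha.card_eq ▸ card_lt hlt) (moves_of_mem_normalizer hR hk)
      · have hyN := toSet_subset_normalizer _ hy
        have hy' := ha.symm.2.2.mem hy
        rw [(hL.conj_conj_of_moves (hL.moves_mul ha.symm hh) ha hyN).2,
          (hL.conj_conj_of_moves ha.symm hh hyN).2, hc _ hy']
        have := (conj_conj_inv (ha.symm.2.2.1 hy)).2
        rwa [PartialGroup.inv_inv] at this
    -- `h` is recovered as the product `a h ^ a a⁻¹` of elements normalizing `Q`
    have h1 := hL.mul_mem_normalizer_of_moves (hL.moves_mul ha hh') ha.symm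
      (hL.mul_mem_normalizer_of_moves ha hh' haQ key) (inv_mem_normalizer haQ)
    have hhN := hL.mem_conjDom_of_mem_normalizer ha hh.2.2
    have h2 : conj (conj h a) (inv a) = h := (conj_conj_inv hhN).2
    have h3 := prod_append [inv a, h] [a] hhN
    rw [prod_single] at h3
    have h4 := prod_append [a, conj h a] [inv a] (hL.mem_dom_of_via (ha.via
      ((show Moves Δ P' (conj h a) P' from ⟨ha.2.1, ha.2.1, hL.conj_mem_normalizer ha hh.2.2⟩).via
        (ha.symm.via ha.1))))
    rw [prod_single] at h4
    rw [← h3] at h1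
    change prod [prod [a, conj h a], inv a] ∈ _ at h1
    rw [← h4] at h1
    have h5 : prod ([a, conj h a] ++ [inv a]) = conj (conj h a) (inv a) := by
      simp only [conj, PartialGroup.inv_inv, List.cons_append, List.nil_append]
    rwa [h5, h2] at h1
  obtain ⟨P₂, hP₂⟩ := hL.exists_moves_of_le_source hg.1 (le_sup_left.trans (hfP₁.le_source hL))
  obtain rfl : P₂ = P' := by
    refine SetLike.coe_injective (Set.image_injective.2 Subtype.val_injective ?_)
    exact hP₂.2.2.2.symm.trans ((Set.image_congr hfg).trans hg.2.2.2)
  have h1 := hL.moves_mul hg hP₂.symm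
  have h2 : prod [g, inv f] ∈ PartialGroup.normalizer (toSet Q) := by
    refine hC _ h1 fun x hx => ?_
    rw [(hL.conj_conj_of_moves hg hP₂.symm (toSet_subset_normalizer P hx)).2, ← hfg x hx]
    exact (conj_conj_inv (hP₂.2.2.1 hx)).2
  -- `g` is the product of `g f⁻¹` and `f`
  have h3 := hL.mul_mem_normalizer_of_moves h1 hP₂ h2 hf
  have hd : [g, inv f, f] ∈ (dom : Set (List L)) :=
    hL.mem_dom_of_via (hg.via (hP₂.symm.via (hP₂.via hP₂.2.1)))
  have e1 := prod_append [g, inv f] [f] hd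
  have e2 := prod_contract [g] [inv f, f] [] (by simpa using hd)
  have e3 : prod [inv f, f] = (prod [] : L) := prod_inv_append _ (single_mem f)
  have e4 := prod_contract [g] [] [] (by simpa using single_mem g)
  simp only [e3, List.cons_append, List.nil_append, List.append_nil, prod_single] at e1 e2 e4
  rwa [← e1, e2, ← e4] at h3

theorem normalizer_eq_univ_of_isNormal (hp : p.Prime) (hL : IsLocality p Δ)
    (hchar : hL.IsOfObjectiveCharacteristic) {Q : Subgroup S}
    (hQ : (FusionSystem.ofPartialGroup S).IsNormal Q) (g : L) :
    g ∈ PartialGroup.normalizer (toSet Q) := by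
  obtain ⟨P, P', h⟩ := hL.exists_moves g
  exact hL.mem_normalizer_of_isNormal hp hchar hQ h

theorem centralizer_eq_univ_of_isCentral (hp : p.Prime) (hL : IsLocality p Δ)
    (hchar : hL.IsOfObjectiveCharacteristic) {Q : Subgroup S}
    (hQ : (FusionSystem.ofPartialGroup S).IsCentral Q) (g : L) :
    g ∈ PartialGroup.centralizer (toSet Q) := by
  have hN := hL.normalizer_eq_univ_of_isNormal hp hchar hQ.isNormal g
  have hQs : Q ≤ hL.source g := fun x hx =>
    ⟨hN.1 (coe_mem_toSet.2 hx), toSet_subset Q (hN.mem (coe_mem_toSet.2 hx))⟩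
  obtain ⟨R, hR⟩ := hL.exists_moves_of_le_source (hL.source_mem g) le_rfl
  obtain ⟨φ, hφ, hφg⟩ := hL.exists_hom_of_moves hR
  obtain ⟨ψ, hψ, h1, h2⟩ := hQ.2 _ _ φ hφ
  rintro _ ⟨x, hx, rfl⟩
  refine ⟨hN.1 (coe_mem_toSet.2 hx), ?_⟩
  rw [← hφg ⟨x, hQs hx⟩]
  have h3 := DFunLike.congr_fun h1 ⟨x, hQs hx⟩
  have h4 := DFunLike.congr_fun h2 ⟨x, hx⟩
  exact congrArg (fun t : (R ⊔ Q : Subgroup S) => t.1.1) (h3.symm.trans h4)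

end IsLocality

end Main

theorem proposition4 {p : ℕ} (hp : p.Prime) {L : Type*} [PartialGroup L] (S : SubgroupIn L)
    (Δ : Set (Subgroup S)) (hL : IsLocality p Δ) (hchar : hL.IsOfObjectiveCharacteristic)
    (F : FusionSystem S) (hF : F = FusionSystem.ofPartialGroup S) (Q : Subgroup S) :
    (F.IsNormal Q ↔ Set.univ = PartialGroup.normalizer (SubgroupIn.toSet Q)) ∧
    (Q ≤ F.center ↔ Set.univ = PartialGroup.centralizer (SubgroupIn.toSet Q)) := by
  subst hF
  have := hL.finite
  have : Finite S := Subtype.finite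
  refine ⟨⟨fun h => ?_, fun h => ?_⟩, ⟨fun h => ?_, fun h => ?_⟩⟩
  · exact (Set.eq_univ_of_forall (hL.normalizer_eq_univ_of_isNormal hp hchar h)).symm
  · exact hL.isNormal_of_normalizer_eq_univ fun g => h ▸ Set.mem_univ g
  · refine (Set.eq_univ_of_forall fun g x hx => ?_).symm
    exact hL.centralizer_eq_univ_of_isCentral hp hchar
      (FusionSystem.isCentral_center _) g x (SubgroupIn.toSet_mono h hx)
  · exact le_sSup (hL.isCentral_of_centralizer_eq_univ fun g => h ▸ Set.mem_univ g)
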